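/- Let $k\ge 1$ and let $\mathbb H^k=\mathbb R^{2k}\times\mathbb R$ be the Heisenberg group with group law $(v,t)\cdot(v',t')=(v+v',\,t+t'+\tfrac12\omega(v,v'))$, $\omega(v,v')=\sum_{j=1}^k (v_jv'_{j+k}-v_{j+k}v'_j)$, Korányi norm $\|(v,t)\|=(|v|^4+16t^2)^{1/4}$ and metric $d(p,q)=\|q^{-1}\cdot p\|$. Closed balls $B(p,r)$, $\operatorname{diam}$, $\operatorname{dist}$ and the $(2k+1)$-dimensional Hausdorff measure $\mathcal H^{2k+1}$ are taken with respect to $d$ ($\operatorname{diam}$ may be $\infty$). For $\nu\in\mathbb S^{2k-1}\subset\mathbb R^{2k}$ let $\mathbb W_\nu=\nu^\perp\times\mathbb R$, $\mathbb L_\nu=\mathbb R\nu\times\{0\}$, and let $\pi_{\mathbb W_\nu}$, $\pi_{\mathbb L_\nu}$ be the projections given by the unique decomposition $p=\pi_{\mathbb W_\nu}(p)\cdot\pi_{\mathbb L_\nu}(p)$ with $\pi_{\mathbb W_\nu}(p)\in\mathbb W_\nu$, $\pi_{\mathbb L_\nu}(p)\in\mathbb L_\nu$. A vertical hyperplane is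 a set $p\cdot\mathbb W_\nu$ with $p\in\mathbb H^k$, $\nu\in\mathbb S^{2k-1}$. For $\gamma>0$ let $C_\gamma(\nu)=\{p:\|\pi_{\mathbb W_\nu}(p)\|\le\gamma\|\pi_{\mathbb L_\nu}(p)\|\}$. For $L>0$, a set $\Gamma\subset\mathbb H^k$ is an intrinsic $L$-Lipschitz graph if there is $\nu\in\mathbb S^{2k-1}$ such that $\pi_{\mathbb W_\nu}(\Gamma)=\mathbb W_\nu$ and $(p\cdot C_{1/L}(\nu))\cap\Gamma=\{p\}$ for all $p\in\Gamma$. Theorem. Let $E\subset\mathbb H^k$ be a closed set such that 1. ($E$ is Ahlfors-regular) there are $C,c>0$ with $\mathcal H^{2k+1}(B(p,r)\cap E)\le C\,r^{2k+1}$ for all $p\in\mathbb H^k$, $r>0$, and $\mathcal H^{2k+1}(B(p,r)\cap E)\ge c\,r^{2k+1}$ for all $p\in E$, $0<r<\operatorname{diam}E$; 2. ($E$ has big vertical projections) there is $c>0$ such that for all $p\in E$ and $0<r<\operatorname{diam}E$ there is $\nu\in\mathbb S^{2k-1}$ with $\mathcal H^{2k+1}(\pi_{\mathbb W_\nu}(B(p,r)\cap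 E))\ge c\,r^{2k+1}$; 3. ($E$ satisfies the weak geometric lemma for vertical hyperplanes) for every $\epsilon>0$ there is $C_\epsilon>0$ such that for all $p\in E$ and $R>0$ $$\int_0^R\mathcal H^{2k+1}\big(\{q\in E\cap B(p,R):\beta_{v,E}(q,s)>\epsilon\}\big)\,\frac{ds}{s}\le C_\epsilon R^{2k+1},\qquad \beta_{v,E}(q,s)=\inf_{\mathbb W}\ \sup_{q'\in B(q,s)\cap E}\frac{\operatorname{dist}(q',\mathbb W)}{s},$$ where the infimum runs over all vertical hyperplanes $\mathbb W$. Then $E$ has big pieces of intrinsic Lipschitz graphs: there are $L>0$ and $c>0$ such that for all $p\in E$ and $0<r<\operatorname{diam}E$ there is an intrinsic $L$-Lipschitz graph $\Gamma$ with $$\mathcal H^{2k+1}(B(p,r)\cap E\cap\Gamma)\ge c\,r^{2k+1}.$$ -/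

import Mathlib

open MeasureTheory Set
open scoped ENNReal MeasureTheory

/-- The underlying set of the `k`-th Heisenberg group, `ℝ^{2k} × ℝ`. The `2k` coordinates of the
first component are indexed by `Fin k ⊕ Fin k`: `inl j` is the `j`-th coordinate and `inr j` is
the `(j + k)`-th one; `EuclideanSpace` carries the Euclidean norm. -/
@[ext]
structure Heisenberg (k : ℕ) where
  v : EuclideanSpace ℝ (Fin k ⊕ Fin k)
  t : ℝ

namespace Heisenberg

variable {k : ℕ}

/-- The form `ω(v, v') = ∑_j v_j v'_{j+k} - v_{j+k} v'_j`. -/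
noncomputable def sympl (v w : EuclideanSpace ℝ (Fin k ⊕ Fin k)) : ℝ :=
  ∑ j : Fin k, (v (Sum.inl j) * w (Sum.inr j) - v (Sum.inr j) * w (Sum.inl j))

theorem sympl_add_left (u v w : EuclideanSpace ℝ (Fin k ⊕ Fin k)) :
    sympl (u + v) w = sympl u w + sympl v w := by
  simp only [sympl, ← Finset.sum_add_distrib, PiLp.add_apply]
  exact Finset.sum_congr rfl fun j _ => by ring

theorem sympl_add_right (u v w : EuclideanSpace ℝ (Fin k ⊕ Fin k)) :
    sympl u (v + w) = sympl u v + sympl u w := by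
  simp only [sympl, ← Finset.sum_add_distrib, PiLp.add_apply]
  exact Finset.sum_congr rfl fun j _ => by ring

theorem sympl_self (v : EuclideanSpace ℝ (Fin k ⊕ Fin k)) : sympl v v = 0 :=
  Finset.sum_eq_zero fun j _ => by ring

theorem sympl_neg_left (v w : EuclideanSpace ℝ (Fin k ⊕ Fin k)) :
    sympl (-v) w = -sympl v w := by
  simp only [sympl, ← Finset.sum_neg_distrib, PiLp.neg_apply]
  exact Finset.sum_congr rfl fun j _ => by ring

theorem sympl_zero_left (w : EuclideanSpace ℝ (Fin k ⊕ Fin k)) :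
    sympl (0 : EuclideanSpace ℝ (Fin k ⊕ Fin k)) w = 0 := by
  simp [sympl]

theorem sympl_zero_right (w : EuclideanSpace ℝ (Fin k ⊕ Fin k)) :
    sympl w (0 : EuclideanSpace ℝ (Fin k ⊕ Fin k)) = 0 := by
  simp [sympl]

/-- The group law `(v,t) · (v',t') = (v + v', t + t' + ω(v,v')/2)`. -/
noncomputable instance : Mul (Heisenberg k) :=
  ⟨fun p q => ⟨p.v + q.v, p.t + q.t + sympl p.v q.v / 2⟩⟩

noncomputable instance : One (Heisenberg k) := ⟨⟨0, 0⟩⟩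

noncomputable instance : Inv (Heisenberg k) := ⟨fun p => ⟨-p.v, -p.t⟩⟩

@[simp] theorem mul_v (p q : Heisenberg k) : (p * q).v = p.v + q.v := rfl
@[simp] theorem mul_t (p q : Heisenberg k) : (p * q).t = p.t + q.t + sympl p.v q.v / 2 := rfl
@[simp] theorem one_v : (1 : Heisenberg k).v = 0 := rfl
@[simp] theorem one_t : (1 : Heisenberg k).t = 0 := rfl
@[simp] theorem inv_v (p : Heisenberg k) : (p⁻¹).v = -p.v := rfl
@[simp] theorem inv_t (p : Heisenberg k) : (p⁻¹).t = -p.t := rfl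

noncomputable instance : Group (Heisenberg k) :=
  Group.ofLeftAxioms
    (fun p q r => Heisenberg.ext (add_assoc _ _ _) (by
      simp only [mul_t, mul_v, sympl_add_left, sympl_add_right]; ring))
    (fun p => Heisenberg.ext (zero_add _) (by simp [sympl_zero_left]))
    (fun p => Heisenberg.ext (neg_add_cancel _) (by simp [sympl_neg_left, sympl_self]))

/-- The Korányi norm `‖(v,t)‖ = (|v|⁴ + 16 t²)^{1/4}`. -/
noncomputable def koranyi (p : Heisenberg k) : ℝ := √(√(‖p.v‖ ^ 4 + 16 * p.t ^ 2))

theorem koranyi_nonneg (p : Heisenberg k) : 0 ≤ koranyi p := Real.sqrt_nonneg _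

theorem koranyi_pow_four (p : Heisenberg k) : koranyi p ^ 4 = ‖p.v‖ ^ 4 + 16 * p.t ^ 2 := by
  rw [show koranyi p ^ 4 = (koranyi p ^ 2) ^ 2 by ring, koranyi, Real.sq_sqrt (Real.sqrt_nonneg _),
    Real.sq_sqrt (by positivity)]

theorem norm_v_le_koranyi (p : Heisenberg k) : ‖p.v‖ ≤ koranyi p := by
  refine le_of_pow_le_pow_left₀ (n := 4) (by norm_num) (koranyi_nonneg p) ?_
  rw [koranyi_pow_four]; nlinarith [sq_nonneg p.t]

theorem koranyi_inv (p : Heisenberg k) : koranyi p⁻¹ = koranyi p := by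
  simp [koranyi]

theorem koranyi_one : koranyi (1 : Heisenberg k) = 0 := by simp [koranyi]

theorem eq_one_of_koranyi_eq_zero {p : Heisenberg k} (h : koranyi p = 0) : p = 1 := by
  have h4 := koranyi_pow_four p
  rw [h] at h4
  have h1 : 0 ≤ ‖p.v‖ ^ 4 := by positivity
  have h2 : ‖p.v‖ ^ 4 = 0 := by nlinarith [sq_nonneg p.t]
  have h3 : p.t ^ 2 = 0 := by nlinarith [sq_nonneg p.t]
  exact Heisenberg.ext (norm_eq_zero.1 (pow_eq_zero_iff (by norm_num) |>.1 h2))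
    (pow_eq_zero_iff (by norm_num) |>.1 h3)

/-- Cauchy-Schwarz for the Hermitian product `⟨v,w⟩ + i ω(v,w)`. -/
theorem inner_sq_add_sympl_sq_le (v w : EuclideanSpace ℝ (Fin k ⊕ Fin k)) :
    (inner ℝ v w) ^ 2 + sympl v w ^ 2 ≤ ‖v‖ ^ 2 * ‖w‖ ^ 2 := by
  let J : EuclideanSpace ℝ (Fin k ⊕ Fin k) := WithLp.toLp 2
    (Sum.elim (fun j => -v (Sum.inr j)) (fun j => v (Sum.inl j)))
  have hJ : inner ℝ J w = sympl v w := by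
    simp only [sympl, PiLp.inner_apply, Fintype.sum_sum_type, ← Finset.sum_add_distrib, J]
    exact Finset.sum_congr rfl fun j _ => by simp; ring
  have hvJ : inner ℝ v J = 0 := by
    simp only [PiLp.inner_apply, Fintype.sum_sum_type, ← Finset.sum_add_distrib, J]
    exact Finset.sum_eq_zero fun j _ => by simp; ring
  have hnJ : inner ℝ J J = ‖v‖ ^ 2 := by
    rw [← real_inner_self_eq_norm_sq]
    simp only [PiLp.inner_apply, Fintype.sum_sum_type, ← Finset.sum_add_distrib, J]
    exact Finset.sum_congr rfl fun j _ => by simp; ring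
  set a : ℝ := inner ℝ v w
  set b : ℝ := sympl v w
  have hz : inner ℝ (a • v + b • J) w = a ^ 2 + b ^ 2 := by
    rw [inner_add_left, real_inner_smul_left, real_inner_smul_left, hJ]; ring
  have hzz : inner ℝ (a • v + b • J) (a • v + b • J) = (a ^ 2 + b ^ 2) * ‖v‖ ^ 2 := by
    rw [inner_add_left, inner_add_right, inner_add_right]
    simp only [real_inner_smul_left, real_inner_smul_right, hnJ, hvJ, real_inner_comm v J,
      real_inner_self_eq_norm_sq v]
    ring
  have hcs := real_inner_mul_inner_self_le (a • v + b • J) w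
  rw [hz, hzz, real_inner_self_eq_norm_sq] at hcs
  rcases (by positivity : (0 : ℝ) ≤ a ^ 2 + b ^ 2).eq_or_lt with h0 | h0
  · rw [← h0]; positivity
  · refine le_of_mul_le_mul_left ?_ h0
    linarith

/-- The triangle inequality for the Korányi norm. -/
theorem koranyi_mul_le (p q : Heisenberg k) : koranyi (p * q) ≤ koranyi p + koranyi q := by
  have hp := koranyi_nonneg p
  have hq := koranyi_nonneg q
  have h4p := koranyi_pow_four p
  have h4q := koranyi_pow_four q
  have hvp := norm_v_le_koranyi p
  have hvq := norm_v_le_koranyi q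
  have key : ∀ P Q R : ℂ, ‖P + Q + R‖ ≤ ‖P‖ + ‖Q‖ + ‖R‖ := fun P Q R => norm_add₃_le
  have hns : ∀ z : ℂ, ‖z‖ ^ 2 = z.re ^ 2 + z.im ^ 2 := fun z => by
    rw [Complex.sq_norm, Complex.normSq_apply]; ring
  let Z : Heisenberg k → ℂ := fun p => ⟨‖p.v‖ ^ 2, 4 * p.t⟩
  have hZ : ∀ p : Heisenberg k, ‖Z p‖ = koranyi p ^ 2 := fun p => by
    rw [← sq_eq_sq₀ (norm_nonneg _) (by positivity), hns,
      show (koranyi p ^ 2) ^ 2 = koranyi p ^ 4 by ring, koranyi_pow_four]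
    simp only [Z]; ring
  let R : ℂ := ⟨2 * inner ℝ p.v q.v, 2 * sympl p.v q.v⟩
  have hR : ‖R‖ ≤ 2 * (‖p.v‖ * ‖q.v‖) := by
    refine le_of_sq_le_sq ?_ (by positivity)
    rw [hns]
    have := inner_sq_add_sympl_sq_le p.v q.v
    simp only [R]
    nlinarith
  have hsum : Z (p * q) = Z p + Z q + R := by
    apply Complex.ext
    · simp only [Z, R, mul_v, Complex.add_re, norm_add_sq_real]; ring
    · simp only [Z, R, mul_t, Complex.add_im]; ring
  have h1 : koranyi (p * q) ^ 2 ≤ (koranyi p + koranyi q) ^ 2 := by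
    rw [← hZ, hsum]
    refine (key _ _ _).trans ?_
    rw [hZ, hZ]
    have : ‖p.v‖ * ‖q.v‖ ≤ koranyi p * koranyi q :=
      mul_le_mul hvp hvq (norm_nonneg _) hp
    nlinarith
  exact le_of_sq_le_sq h1 (by positivity)

/-- The Korányi metric `d(p,q) = ‖q⁻¹ · p‖`. All metric notions (topology, closed balls, diameter,
distance to a set, Hausdorff measures) refer to it. -/
noncomputable instance : MetricSpace (Heisenberg k) where
  dist p q := koranyi (q⁻¹ * p)
  dist_self p := by rw [inv_mul_cancel, koranyi_one]
  dist_comm p q := by rw [← koranyi_inv, mul_inv_rev, inv_inv]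
  dist_triangle p q r := by
    have h := koranyi_mul_le (r⁻¹ * q) (q⁻¹ * p)
    rw [show r⁻¹ * q * (q⁻¹ * p) = r⁻¹ * p by group] at h
    linarith
  eq_of_dist_eq_zero {p q} h := (inv_mul_eq_one.1 (eq_one_of_koranyi_eq_zero h)).symm

theorem dist_eq (p q : Heisenberg k) : dist p q = koranyi (q⁻¹ * p) := rfl

noncomputable instance : MeasurableSpace (Heisenberg k) := borel _

instance : BorelSpace (Heisenberg k) := ⟨rfl⟩

/-- The `(2k+1)`-dimensional Hausdorff measure with respect to the Korányi metric. -/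
noncomputable def hausdorff (k : ℕ) : Measure (Heisenberg k) := μH[(2 * k + 1 : ℝ)]

/-- The vertical subgroup `𝕎_ν = ν^⊥ × ℝ`. -/
def vertical (ν : EuclideanSpace ℝ (Fin k ⊕ Fin k)) : Set (Heisenberg k) :=
  {p | inner ℝ p.v ν = 0}

/-- The horizontal subgroup `𝕃_ν = ℝν × {0}`. -/
def horizontal (ν : EuclideanSpace ℝ (Fin k ⊕ Fin k)) : Set (Heisenberg k) :=
  {p | (∃ a : ℝ, p.v = a • ν) ∧ p.t = 0}

/-- The vertical projection
`π_{𝕎_ν}(v,t) = (v - ⟨v,ν⟩ν, t - ω(v, ⟨v,ν⟩ν)/2)`, for a unit vector `ν`. -/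
noncomputable def projV (ν : EuclideanSpace ℝ (Fin k ⊕ Fin k)) (p : Heisenberg k) :
    Heisenberg k :=
  ⟨p.v - (inner ℝ p.v ν : ℝ) • ν, p.t - sympl p.v ((inner ℝ p.v ν : ℝ) • ν) / 2⟩

/-- The horizontal projection `π_{𝕃_ν}(v,t) = (⟨v,ν⟩ν, 0)`, for a unit vector `ν`. -/
noncomputable def projH (ν : EuclideanSpace ℝ (Fin k ⊕ Fin k)) (p : Heisenberg k) :
    Heisenberg k :=
  ⟨(inner ℝ p.v ν : ℝ) • ν, 0⟩

/-- For a unit vector `ν`, the pair `(π_{𝕎_ν}(p), π_{𝕃_ν}(p))` is the unique pair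
`(w, l) ∈ 𝕎_ν × 𝕃_ν` with `p = w · l`. -/
theorem eq_mul_iff_eq_proj {ν : EuclideanSpace ℝ (Fin k ⊕ Fin k)} (hν : ‖ν‖ = 1)
    (p w l : Heisenberg k) :
    (w ∈ vertical ν ∧ l ∈ horizontal ν ∧ p = w * l) ↔ (w = projV ν p ∧ l = projH ν p) := by
  have hνν : inner ℝ ν ν = (1 : ℝ) := by rw [real_inner_self_eq_norm_sq, hν]; norm_num
  constructor
  · rintro ⟨hw, ⟨⟨a, ha⟩, hl⟩, rfl⟩
    have hw' : inner ℝ w.v ν = (0 : ℝ) := hw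
    have hin : inner ℝ (w * l).v ν = a := by
      rw [mul_v, inner_add_left, hw', ha, real_inner_smul_left, hνν]; ring
    refine ⟨Heisenberg.ext ?_ ?_, Heisenberg.ext ?_ ?_⟩
    · simp only [projV, hin]; simp [ha]
    · simp only [projV]
      rw [hin, ← ha, mul_t, mul_v, sympl_add_left, sympl_self, hl]
      ring
    · simp only [projH, hin, ha]
    · simp only [projH, hl]
  · rintro ⟨rfl, rfl⟩
    refine ⟨?_, ⟨⟨_, rfl⟩, rfl⟩, Heisenberg.ext ?_ ?_⟩
    · simp only [vertical, projV, mem_ofPred_eq, inner_sub_left, real_inner_smul_left, hνν]; ring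
    · simp [projV, projH]
    · simp only [projV, projH, mul_t, sub_eq_add_neg, sympl_add_left, sympl_neg_left, sympl_self]
      ring

/-- The Heisenberg cone `C_γ(ν)` with vertex at the origin, opening `γ` and direction `ν`. -/
def cone (γ : ℝ) (ν : EuclideanSpace ℝ (Fin k ⊕ Fin k)) : Set (Heisenberg k) :=
  {p | koranyi (projV ν p) ≤ γ * koranyi (projH ν p)}

/-- Intrinsic `(L,ν)`-Lipschitz graphs over `𝕎_ν`: `π_{𝕎_ν}(Γ) = 𝕎_ν` and
`(p · C_{1/L}(ν)) ∩ Γ = {p}` for all `p ∈ Γ`. -/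
def IsIntrinsicLipschitzGraphOver (L : ℝ) (ν : EuclideanSpace ℝ (Fin k ⊕ Fin k))
    (Γ : Set (Heisenberg k)) : Prop :=
  projV ν '' Γ = vertical ν ∧
    ∀ p ∈ Γ, ((fun q => p * q) '' cone (1 / L) ν) ∩ Γ = {p}

/-- Intrinsic `L`-Lipschitz graphs. -/
def IsIntrinsicLipschitzGraph (L : ℝ) (Γ : Set (Heisenberg k)) : Prop :=
  ∃ ν : EuclideanSpace ℝ (Fin k ⊕ Fin k), ‖ν‖ = 1 ∧ IsIntrinsicLipschitzGraphOver L ν Γ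

/-- Upper Ahlfors-regularity with dimension `2k+1`. -/
def UpperAhlforsRegular (E : Set (Heisenberg k)) : Prop :=
  ∃ C : ℝ, 0 < C ∧ ∀ (p : Heisenberg k) (r : ℝ), 0 < r →
    hausdorff k (Metric.closedBall p r ∩ E) ≤ ENNReal.ofReal (C * r ^ (2 * k + 1))

/-- Lower Ahlfors-regularity with dimension `2k+1`. The diameter is `∞` if `E` is unbounded. -/
def LowerAhlforsRegular (E : Set (Heisenberg k)) : Prop :=
  ∃ c : ℝ, 0 < c ∧ ∀ p ∈ E, ∀ r : ℝ, 0 < r → ENNReal.ofReal r < Metric.ediam E →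
    ENNReal.ofReal (c * r ^ (2 * k + 1)) ≤ hausdorff k (Metric.closedBall p r ∩ E)

/-- Ahlfors-regularity with dimension `2k+1`. -/
def AhlforsRegular (E : Set (Heisenberg k)) : Prop :=
  UpperAhlforsRegular E ∧ LowerAhlforsRegular E

/-- Big vertical projections. -/
def HasBVP (E : Set (Heisenberg k)) : Prop :=
  ∃ c : ℝ, 0 < c ∧ ∀ p ∈ E, ∀ r : ℝ, 0 < r → ENNReal.ofReal r < Metric.ediam E →
    ∃ ν : EuclideanSpace ℝ (Fin k ⊕ Fin k), ‖ν‖ = 1 ∧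
      ENNReal.ofReal (c * r ^ (2 * k + 1)) ≤
        hausdorff k (projV ν '' (Metric.closedBall p r ∩ E))

/-- Vertical hyperplanes: left translates `p · 𝕎_ν` of vertical subgroups. -/
def IsVerticalHyperplane (W : Set (Heisenberg k)) : Prop :=
  ∃ (p : Heisenberg k) (ν : EuclideanSpace ℝ (Fin k ⊕ Fin k)), ‖ν‖ = 1 ∧
    W = (fun q => p * q) '' vertical ν

/-- The number `β_{v,E}(p,s) = inf_𝕎 sup_{q ∈ B(p,s) ∩ E} dist(q,𝕎)/s`, the infimum being taken
over all vertical hyperplanes `𝕎`. -/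
noncomputable def betaV (E : Set (Heisenberg k)) (p : Heisenberg k) (s : ℝ) : ℝ≥0∞ :=
  ⨅ (W : Set (Heisenberg k)) (_ : IsVerticalHyperplane W),
    ⨆ q ∈ Metric.closedBall p s ∩ E, Metric.infEDist q W / ENNReal.ofReal s

/-- The weak geometric lemma for vertical hyperplanes. The constant may depend on `ε`
(and on `E` and `k`), but not on `p` and `R`. -/
def SatisfiesWGL (E : Set (Heisenberg k)) : Prop :=
  ∀ ε : ℝ, 0 < ε → ∃ C : ℝ, 0 < C ∧ ∀ p ∈ E, ∀ R : ℝ, 0 < R →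
    ∫⁻ s in Ioo 0 R,
      hausdorff k {q ∈ E ∩ Metric.closedBall p R | ENNReal.ofReal ε < betaV E q s} /
        ENNReal.ofReal s ≤ ENNReal.ofReal (C * R ^ (2 * k + 1))

/-- Big pieces of intrinsic Lipschitz graphs. -/
def HasBPiLG (E : Set (Heisenberg k)) : Prop :=
  ∃ L c : ℝ, 0 < L ∧ 0 < c ∧
    ∀ p ∈ E, ∀ r : ℝ, 0 < r → ENNReal.ofReal r < Metric.ediam E →
      ∃ Γ : Set (Heisenberg k), IsIntrinsicLipschitzGraph L Γ ∧
        ENNReal.ofReal (c * r ^ (2 * k + 1)) ≤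
          hausdorff k (Metric.closedBall p r ∩ E ∩ Γ)

end Heisenberg

/-!
The graphs are found by a variant of the David--Semmes argument without dyadic cubes.

Fix a ball `B(p, r)` centred on `E` and a direction `ν` for which the vertical projection of
`E ∩ B(p, r)` has measure at least `b r ^ (2k+1)`. Write `π` for `projV ν`. Three facts about `π`
are needed. It increases `H^{2k+1}` at most by a constant factor (`hausdorff_projV_le`); the
projection of a thin neighbourhood of a vertical hyperplane is small if the normal `ν'` of the
hyperplane is almost orthogonal to `ν` (`hausdorff_projV_le_of_inner_le`); and the set `L` of points
lying in a ball `B` of radius `ρ ≤ 2r` for which `π(E ∩ B)` is smaller than `δ ρ ^ (2k+1)` has a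
projection of measure `≲ δ r ^ (2k+1)`, by Vitali's covering lemma
(`hausdorff_projV_lowDensity_le`). The first two rest on the fact that, although `π` is not
Lipschitz, the maps `w ↦ π(x · w)` of `𝕎_ν` are shears and preserve Lebesgue measure.

Call a dyadic scale bad for a point if the `β`-number there exceeds a threshold. By the weak
geometric lemma, outside a set of small measure every point has at most `N` bad scales. So the set
`G` of points outside `L` with at most `N` bad scales still has a large projection, hence
large measure. If `x ∈ G`, if the scale `j` is good for `x`, and if `y ∈ E` has distance about `2^{-j} r`
from `x`, then `E` is close to a vertical hyperplane near `x` at that scale; since `x ∉ L`, its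
normal is not almost orthogonal to `ν`, and so `x⁻¹ · y` avoids a cone around `ν`
(`notMem_posCone_of_inner_le`).

It remains to select from `G` a subset of comparable measure in which no pair `x, y` has its own
scale bad for both points. At every scale `j`, cover `E ∩ B(p, r)` by `Q` colour classes
such that no two points of one class have a distance comparable to `2^{-j} r`
(`exists_open_cover_forall_dist_le_half`). Choose a random colour `ξ j` for each scale, and keep the
points that carry the colour `ξ j` at each of their bad scales. A point with at most `N` bad scales
survives with probability at least `Q ^ (-N)`, so some choice of `ξ` keeps the proportion `Q ^ (-N)`
of `G` (`exists_colour_sequence`).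

The selected set extends to an entire intrinsic Lipschitz graph
(`exists_isIntrinsicLipschitzGraphOver_superset`): the cones are replaced by comparable ones that
are semigroups, and the graph is the lower boundary of the product of the set with the semigroup.
-/

/-! ### Semigroup cones and the extension of intrinsic Lipschitz graphs -/

namespace Heisenberg

variable {k : ℕ}

theorem sympl_smul_left (a : ℝ) (v w : EuclideanSpace ℝ (Fin k ⊕ Fin k)) :
    sympl (a • v) w = a * sympl v w := by
  simp only [sympl, Finset.mul_sum, PiLp.smul_apply, smul_eq_mul]
  exact Finset.sum_congr rfl fun j _ => by ring

theorem sympl_smul_right (a : ℝ) (v w : EuclideanSpace ℝ (Fin k ⊕ Fin k)) :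
    sympl v (a • w) = a * sympl v w := by
  simp only [sympl, Finset.mul_sum, PiLp.smul_apply, smul_eq_mul]
  exact Finset.sum_congr rfl fun j _ => by ring

theorem sympl_swap (v w : EuclideanSpace ℝ (Fin k ⊕ Fin k)) : sympl w v = -sympl v w := by
  simp only [sympl, ← Finset.sum_neg_distrib]
  exact Finset.sum_congr rfl fun j _ => by ring

theorem abs_sympl_le (v w : EuclideanSpace ℝ (Fin k ⊕ Fin k)) : |sympl v w| ≤ ‖v‖ * ‖w‖ := by
  refine abs_le_of_sq_le_sq ?_ (by positivity)
  have := inner_sq_add_sympl_sq_le v w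
  nlinarith [sq_nonneg (inner ℝ v w : ℝ)]

/-- The point `(aν, 0)` of the horizontal subgroup `𝕃_ν`. -/
noncomputable def horiz (ν : EuclideanSpace ℝ (Fin k ⊕ Fin k)) (a : ℝ) : Heisenberg k :=
  ⟨a • ν, 0⟩

@[simp] theorem horiz_v (ν : EuclideanSpace ℝ (Fin k ⊕ Fin k)) (a : ℝ) :
    (horiz ν a).v = a • ν := rfl

@[simp] theorem horiz_t (ν : EuclideanSpace ℝ (Fin k ⊕ Fin k)) (a : ℝ) :
    (horiz ν a).t = 0 := rfl

theorem horiz_mul_horiz (ν : EuclideanSpace ℝ (Fin k ⊕ Fin k)) (a b : ℝ) :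
    horiz ν a * horiz ν b = horiz ν (a + b) := by
  ext1
  · simp [add_smul]
  · simp [sympl_smul_left, sympl_smul_right, sympl_self]

theorem horiz_zero (ν : EuclideanSpace ℝ (Fin k ⊕ Fin k)) : horiz ν 0 = 1 := by
  ext1 <;> simp

theorem horiz_inv (ν : EuclideanSpace ℝ (Fin k ⊕ Fin k)) (a : ℝ) :
    (horiz ν a)⁻¹ = horiz ν (-a) := by
  rw [inv_eq_iff_mul_eq_one, horiz_mul_horiz, add_neg_cancel, horiz_zero]

/-- The one-sided homogeneous cone of aperture `m` around the ray `{(aν, 0) : a ≥ 0}`. Unlike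
`cone`, it is closed under multiplication (for `m ≤ 1`), and it is comparable to one half of
`cone`. -/
def posCone (m : ℝ) (ν : EuclideanSpace ℝ (Fin k ⊕ Fin k)) : Set (Heisenberg k) :=
  {z | 0 ≤ inner ℝ z.v ν ∧ ‖z.v - (inner ℝ z.v ν : ℝ) • ν‖ ≤ m * inner ℝ z.v ν ∧
    |z.t| ≤ m * (inner ℝ z.v ν : ℝ) ^ 2}

theorem inner_smul_self {ν : EuclideanSpace ℝ (Fin k ⊕ Fin k)} (hν : ‖ν‖ = 1) (a : ℝ) :
    inner ℝ (a • ν) ν = a := by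
  rw [real_inner_smul_left, real_inner_self_eq_norm_sq, hν]; ring

theorem horiz_mem_posCone {ν : EuclideanSpace ℝ (Fin k ⊕ Fin k)} (hν : ‖ν‖ = 1) {m a : ℝ}
    (hm : 0 ≤ m) (ha : 0 ≤ a) : horiz ν a ∈ posCone m ν := by
  simp only [posCone, mem_ofPred_eq, horiz_v, horiz_t, inner_smul_self hν]
  refine ⟨ha, ?_, ?_⟩
  · simp only [sub_self, norm_zero]; positivity
  · simp only [abs_zero]; positivity

theorem one_mem_posCone {ν : EuclideanSpace ℝ (Fin k ⊕ Fin k)} (hν : ‖ν‖ = 1) {m : ℝ}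
    (hm : 0 ≤ m) : (1 : Heisenberg k) ∈ posCone m ν :=
  horiz_zero ν ▸ horiz_mem_posCone hν hm le_rfl

/-- The symplectic form of two vectors, in terms of their components along and across `ν`. -/
theorem sympl_decomp (ν v w : EuclideanSpace ℝ (Fin k ⊕ Fin k)) (a b : ℝ) :
    sympl v w = a * sympl ν (w - b • ν) - b * sympl ν (v - a • ν) +
      sympl (v - a • ν) (w - b • ν) := by
  conv_lhs => rw [← sub_add_cancel v (a • ν), ← sub_add_cancel w (b • ν)]
  rw [sympl_add_left, sympl_add_right, sympl_add_right, sympl_smul_left, sympl_smul_left,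
    sympl_smul_right, sympl_smul_right, sympl_self, sympl_swap ν (v - a • ν)]
  ring

theorem mul_mem_posCone {ν : EuclideanSpace ℝ (Fin k ⊕ Fin k)} (hν : ‖ν‖ = 1) {m : ℝ}
    (hm : 0 ≤ m) (hm1 : m ≤ 1) {z w : Heisenberg k} (hz : z ∈ posCone m ν)
    (hw : w ∈ posCone m ν) : z * w ∈ posCone m ν := by
  obtain ⟨ha, hu, ht⟩ := hz
  obtain ⟨hb, hu', ht'⟩ := hw
  simp only [posCone, mem_ofPred_eq, mul_v, mul_t, inner_add_left]
  set a : ℝ := inner ℝ z.v ν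
  set b : ℝ := inner ℝ w.v ν
  refine ⟨add_nonneg ha hb, ?_, ?_⟩
  · calc ‖z.v + w.v - (a + b) • ν‖ = ‖(z.v - a • ν) + (w.v - b • ν)‖ := by
          congr 1; rw [add_smul]; abel
      _ ≤ _ := (norm_add_le _ _).trans (by linarith)
  · have h1 := abs_sympl_le ν (w.v - b • ν)
    have h2 := abs_sympl_le ν (z.v - a • ν)
    have h3 := abs_sympl_le (z.v - a • ν) (w.v - b • ν)
    rw [hν, one_mul] at h1 h2
    have h4 : ‖z.v - a • ν‖ * ‖w.v - b • ν‖ ≤ m * a * (m * b) := by gcongr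
    have hs : |sympl z.v w.v| ≤ 3 * m * (a * b) := by
      rw [sympl_decomp ν z.v w.v a b]
      refine (abs_add_le _ _).trans ?_
      have h5 : |a * sympl ν (w.v - b • ν) - b * sympl ν (z.v - a • ν)| ≤
          a * (m * b) + b * (m * a) := by
        refine (abs_sub _ _).trans ?_
        rw [abs_mul, abs_mul, abs_of_nonneg ha, abs_of_nonneg hb]
        gcongr
        · exact h1.trans hu'
        · exact h2.trans hu
      have h6 : m * a * (m * b) ≤ m * (a * b) := by
        have : m * m * (a * b) ≤ 1 * m * (a * b) := by gcongr
        linarith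
      linarith
    rw [abs_le] at *
    have hab : 0 ≤ m * (a * b) := by positivity
    constructor <;> nlinarith

/-- A Heisenberg cone is contained in the union of the two opposite semigroup cones. -/
theorem mem_posCone_or_inv_mem_of_mem_cone {ν : EuclideanSpace ℝ (Fin k ⊕ Fin k)} (hν : ‖ν‖ = 1)
    {m : ℝ} (hm : 0 ≤ m) (hm1 : m ≤ 1) {z : Heisenberg k} (hz : z ∈ cone m ν) :
    z ∈ posCone m ν ∨ z⁻¹ ∈ posCone m ν := by
  have h0 : koranyi (projV ν z) ≤ m * koranyi (projH ν z) := hz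
  set a : ℝ := inner ℝ z.v ν with ha
  have hH : koranyi (projH ν z) = |a| := by
    refine (pow_left_inj₀ (koranyi_nonneg _) (abs_nonneg _) (four_ne_zero)).1 ?_
    rw [koranyi_pow_four]; simp [projH, norm_smul, hν, ← ha]
  rw [hH] at h0
  have hu : ‖z.v - a • ν‖ ≤ m * |a| := (norm_v_le_koranyi (projV ν z)).trans h0
  have ht' : |z.t - sympl z.v (a • ν) / 2| ≤ m ^ 2 * a ^ 2 / 4 := by
    have h4 := pow_le_pow_left₀ (koranyi_nonneg _) h0 4
    rw [koranyi_pow_four, mul_pow, Even.pow_abs (by decide : Even 4)] at h4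
    have h5 : 16 * (z.t - sympl z.v (a • ν) / 2) ^ 2 ≤ m ^ 4 * a ^ 4 :=
      le_trans (le_add_of_nonneg_left (by positivity)) h4
    refine abs_le_of_sq_le_sq ?_ (by positivity)
    nlinarith
  have hs : |sympl z.v (a • ν)| ≤ m * a ^ 2 := by
    rw [show sympl z.v (a • ν) = a * sympl (z.v - a • ν) ν by
      rw [sub_eq_add_neg, sympl_add_left, sympl_neg_left, sympl_smul_left, sympl_smul_right,
        sympl_self]; ring, abs_mul]
    have := abs_sympl_le (z.v - a • ν) ν
    rw [hν, mul_one] at this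
    calc |a| * |sympl (z.v - a • ν) ν| ≤ |a| * (m * |a|) := by gcongr; exact this.trans hu
      _ = m * a ^ 2 := by rw [← sq_abs a]; ring
  have ht : |z.t| ≤ m * a ^ 2 := by
    have h1 : m ^ 2 * a ^ 2 ≤ m * a ^ 2 := by
      have : m * m * a ^ 2 ≤ 1 * m * a ^ 2 := by gcongr
      linarith
    have h2 : 0 ≤ m * a ^ 2 := by positivity
    rw [abs_le] at *
    constructor <;> linarith
  rcases le_total 0 a with h | h
  · left
    exact ⟨h, by rwa [abs_of_nonneg h] at hu, ht⟩
  · right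
    simp only [posCone, mem_ofPred_eq, inv_v, inv_t, inner_neg_left, ← ha]
    refine ⟨by linarith, ?_, by simpa using ht⟩
    rw [abs_of_nonpos h] at hu
    rwa [neg_smul, ← neg_sub', norm_neg]

/-- Shortening a nontrivial element of the cone of aperture `m / 2` on both sides by a small
amount in the direction `ν` keeps it in the cone of aperture `m`. -/
theorem exists_horiz_mul_mul_horiz_mem_posCone {ν : EuclideanSpace ℝ (Fin k ⊕ Fin k)}
    (hν : ‖ν‖ = 1) {m : ℝ} (hm : 0 ≤ m) {z : Heisenberg k} (hz : z ∈ posCone (m / 2) ν)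
    (hz1 : z ≠ 1) : ∃ η : ℝ, 0 < η ∧ horiz ν (-η) * z * horiz ν (-η) ∈ posCone m ν := by
  obtain ⟨ha, hu, ht⟩ := hz
  set a : ℝ := inner ℝ z.v ν with ha_def
  have hapos : 0 < a := by
    refine lt_of_le_of_ne ha fun h0 => hz1 ?_
    rw [← h0] at hu ht
    ext1
    · simpa using hu
    · simpa using ht
  refine ⟨a / 8, by positivity, ?_⟩
  have hin : inner ℝ (-(a / 8) • ν + z.v + -(a / 8) • ν) ν = 3 / 4 * a := by
    rw [inner_add_left, inner_add_left, inner_smul_self hν, ← ha_def]; ring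
  simp only [posCone, mem_ofPred_eq, mul_v, mul_t, horiz_v, horiz_t, hin]
  refine ⟨by positivity, ?_, ?_⟩
  · rw [show -(a / 8) • ν + z.v + -(a / 8) • ν - (3 / 4 * a) • ν = z.v - a • ν by module]
    nlinarith
  · rw [sympl_add_left, sympl_smul_left, sympl_smul_left, sympl_smul_right, sympl_smul_right,
      sympl_self, sympl_swap ν z.v]
    refine le_of_eq_of_le (congrArg _ (by ring : _ = z.t)) (ht.trans ?_)
    nlinarith [mul_nonneg hm (sq_nonneg a)]

theorem inner_mul_v (p q : Heisenberg k) (ν : EuclideanSpace ℝ (Fin k ⊕ Fin k)) :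
    inner ℝ (p * q).v ν = (inner ℝ p.v ν + inner ℝ q.v ν : ℝ) := by
  rw [mul_v, inner_add_left]

/-- Every point moved far enough in the direction `ν` enters the cone. -/
theorem exists_mul_horiz_mem_posCone {ν : EuclideanSpace ℝ (Fin k ⊕ Fin k)}
    (hν : ‖ν‖ = 1) {m : ℝ} (hm : 0 < m) (z : Heisenberg k) :
    ∃ a : ℝ, z * horiz ν a ∈ posCone m ν := by
  set b : ℝ := inner ℝ z.v ν with hb
  set u := ‖z.v - b • ν‖
  set σ := |sympl z.v ν|
  set x := 1 + u / m + (|z.t| + σ * |b| + σ) / m with hx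
  have hx1 : 1 ≤ x := by
    rw [hx, add_assoc]; exact le_add_of_nonneg_right (by positivity)
  have hxu : u ≤ m * x := by
    have : m * x = m + u + (|z.t| + σ * |b| + σ) := by rw [hx]; field_simp
    have : 0 ≤ |z.t| + σ * |b| + σ := by positivity
    linarith
  have hxt : |z.t| + σ * |b| + σ ≤ m * x := by
    have : m * x = m + u + (|z.t| + σ * |b| + σ) := by rw [hx]; field_simp
    have : 0 ≤ u := norm_nonneg _
    linarith
  refine ⟨x - b, ?_⟩
  have hin : inner ℝ (z * horiz ν (x - b)).v ν = x := by
    rw [inner_mul_v, horiz_v, inner_smul_self hν, ← hb]; ring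
  simp only [posCone, mem_ofPred_eq, hin]
  refine ⟨by linarith, ?_, ?_⟩
  · rwa [mul_v, horiz_v, show z.v + (x - b) • ν - x • ν = z.v - b • ν by module]
  · rw [mul_t, horiz_v, horiz_t, sympl_smul_right]
    have h1 : |z.t + 0 + (x - b) * sympl z.v ν / 2| ≤ |z.t| + (x + |b|) * σ := by
      refine (abs_add_le _ _).trans ?_
      rw [add_zero, abs_div, abs_mul, abs_two]
      have : |x - b| ≤ x + |b| := (abs_sub _ _).trans (by rw [abs_of_nonneg (by linarith : 0 ≤ x)])
      have h2 : |x - b| * σ ≤ (x + |b|) * σ := by gcongr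
      have : 0 ≤ |x - b| * σ := by positivity
      simp only [σ] at *
      linarith
    have h3 : (|z.t| + σ * |b|) * 1 ≤ (|z.t| + σ * |b|) * x := by gcongr
    have h4 : (|z.t| + σ * |b| + σ) * x ≤ m * x * x := by gcongr
    nlinarith

theorem projV_mul_horiz {ν : EuclideanSpace ℝ (Fin k ⊕ Fin k)} (hν : ‖ν‖ = 1)
    (p : Heisenberg k) : projV ν p * horiz ν (inner ℝ p.v ν) = p :=
  (((eq_mul_iff_eq_proj hν p (projV ν p) (projH ν p)).2 ⟨rfl, rfl⟩).2.2).symm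

theorem projV_mem_vertical {ν : EuclideanSpace ℝ (Fin k ⊕ Fin k)} (hν : ‖ν‖ = 1)
    (p : Heisenberg k) : projV ν p ∈ vertical ν :=
  ((eq_mul_iff_eq_proj hν p (projV ν p) (projH ν p)).2 ⟨rfl, rfl⟩).1

theorem projV_of_mul_horiz {ν : EuclideanSpace ℝ (Fin k ⊕ Fin k)} (hν : ‖ν‖ = 1)
    {w : Heisenberg k} (hw : w ∈ vertical ν) (a : ℝ) : projV ν (w * horiz ν a) = w :=
  ((eq_mul_iff_eq_proj hν (w * horiz ν a) w (horiz ν a)).1 ⟨hw, ⟨⟨a, rfl⟩, rfl⟩, rfl⟩).1.symm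

/-- The extension theorem for intrinsic Lipschitz graphs: a bounded set whose points do not see
each other in the semigroup cone is contained in an entire intrinsic Lipschitz graph, namely the
lower boundary, in the direction `ν`, of the set `F · posCone m ν`. -/
theorem exists_isIntrinsicLipschitzGraphOver_superset {ν : EuclideanSpace ℝ (Fin k ⊕ Fin k)}
    (hν : ‖ν‖ = 1) {m : ℝ} (hm : 0 < m) (hm1 : m ≤ 1) {F : Set (Heisenberg k)}
    (hne : F.Nonempty) {R : ℝ} (hR : ∀ p ∈ F, ‖p.v‖ ≤ R)
    (hF : ∀ p ∈ F, ∀ q ∈ F, p⁻¹ * q ∈ posCone m ν → p = q) :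
    ∃ Γ : Set (Heisenberg k), F ⊆ Γ ∧ IsIntrinsicLipschitzGraphOver (2 / m) ν Γ := by
  let U : Set (Heisenberg k) := {x | ∃ p ∈ F, p⁻¹ * x ∈ posCone m ν}
  have hFU : F ⊆ U := fun p hp => ⟨p, hp, by simpa using one_mem_posCone hν hm.le⟩
  have hUK : ∀ x ∈ U, ∀ z ∈ posCone m ν, x * z ∈ U := by
    rintro x ⟨p, hp, hx⟩ z hz
    exact ⟨p, hp, by rw [← mul_assoc]; exact mul_mem_posCone hν hm.le hm1 hx hz⟩
  let S : Heisenberg k → Set ℝ := fun w => {a | w * horiz ν a ∈ U}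
  have hSne : ∀ w, (S w).Nonempty := fun w => by
    obtain ⟨p, hp⟩ := hne
    obtain ⟨a, ha⟩ := exists_mul_horiz_mem_posCone hν hm (p⁻¹ * w)
    exact ⟨a, p, hp, by rwa [← mul_assoc]⟩
  have hSbdd : ∀ w, BddBelow (S w) := fun w => by
    refine ⟨-R - inner ℝ w.v ν, ?_⟩
    rintro a ⟨p, hp, h, -⟩
    rw [inner_mul_v, inner_mul_v, horiz_v, inner_smul_self hν, inv_v, inner_neg_left] at h
    have := (abs_real_inner_le_norm p.v ν).trans_eq (by rw [hν, mul_one])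
    rw [abs_le] at this
    linarith [hR p hp]
  have hSup : ∀ w a b, a ∈ S w → a ≤ b → b ∈ S w := fun w a b ha hab => by
    have := hUK _ ha _ (horiz_mem_posCone hν hm.le (sub_nonneg.2 hab))
    rwa [mul_assoc, horiz_mul_horiz, add_sub_cancel] at this
  let Γ : Set (Heisenberg k) := (fun w => w * horiz ν (sInf (S w))) '' vertical ν
  -- Points slightly above `Γ` lie in `U`, points slightly below do not.
  have habove : ∀ x ∈ Γ, ∀ η : ℝ, 0 < η → x * horiz ν η ∈ U := by
    rintro _ ⟨w, hw, rfl⟩ η hη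
    obtain ⟨a, ha, hlt⟩ := exists_lt_of_csInf_lt (hSne w) (lt_add_of_pos_right (sInf (S w)) hη)
    simp only [mul_assoc, horiz_mul_horiz]
    exact hSup w a _ ha hlt.le
  have hbelow : ∀ x ∈ Γ, ∀ η : ℝ, 0 < η → x * horiz ν (-η) ∉ U := by
    rintro _ ⟨w, hw, rfl⟩ η hη h
    simp only [mul_assoc, horiz_mul_horiz] at h
    have := csInf_le (hSbdd w) (show sInf (S w) + -η ∈ S w from h)
    linarith
  have hcone : ∀ x ∈ Γ, ∀ y ∈ Γ, x⁻¹ * y ∈ posCone (m / 2) ν → x = y := by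
    intro x hx y hy hxy
    by_contra hne
    obtain ⟨η, hη, hmem⟩ := exists_horiz_mul_mul_horiz_mem_posCone hν hm.le hxy
      (fun h => hne (inv_mul_eq_one.1 h))
    refine hbelow y hy η hη ?_
    have := hUK _ (habove x hx η hη) _ hmem
    rwa [show x * horiz ν η * (horiz ν (-η) * (x⁻¹ * y) * horiz ν (-η)) = y * horiz ν (-η) by
      rw [← horiz_inv]; group] at this
  refine ⟨Γ, fun p hp => ?_, ?_, fun p hp => ?_⟩
  · refine ⟨projV ν p, projV_mem_vertical hν p, ?_⟩
    suffices h : sInf (S (projV ν p)) = inner ℝ p.v ν by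
      simp only [h, projV_mul_horiz hν]
    refine le_antisymm (csInf_le (hSbdd _) ?_) (le_csInf (hSne _) ?_)
    · change projV ν p * _ ∈ U
      rw [projV_mul_horiz hν]; exact hFU hp
    · rintro b ⟨q, hq, hqb⟩
      by_contra! hlt
      have h1 := mul_mem_posCone hν hm.le hm1 hqb (horiz_mem_posCone hν hm.le (sub_nonneg.2 hlt.le))
      rw [mul_assoc, mul_assoc, horiz_mul_horiz, add_sub_cancel, projV_mul_horiz hν] at h1
      have h2 := hF q hq p hp h1
      subst h2
      have h3 := hqb.1
      rw [inner_mul_v, inner_mul_v, horiz_v, inner_smul_self hν, inv_v, inner_neg_left,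
        show inner ℝ (projV ν q).v ν = (0 : ℝ) from projV_mem_vertical hν q] at h3
      linarith
  · ext w
    constructor
    · rintro ⟨_, ⟨w', hw', rfl⟩, rfl⟩
      rw [projV_of_mul_horiz hν hw']; exact hw'
    · intro hw
      exact ⟨_, ⟨w, hw, rfl⟩, projV_of_mul_horiz hν hw _⟩
  · rw [one_div_div]
    ext q
    constructor
    · rintro ⟨⟨z, hz, rfl⟩, hq⟩
      rcases mem_posCone_or_inv_mem_of_mem_cone hν (by positivity) (by linarith) hz with h | h
      · exact (hcone p hp _ hq (by simpa using h)).symm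
      · exact hcone _ hq p hp (by simpa using h)
    · rintro rfl
      refine ⟨⟨1, ?_, mul_one _⟩, hp⟩
      simp only [cone, mem_ofPred_eq, projV, projH, one_v, one_t, inner_zero_left, zero_smul,
        sympl_zero_left]
      simp [koranyi]

end Heisenberg

/-! ### Measure estimates for vertical projections -/

namespace Heisenberg

variable {k : ℕ}

theorem continuous_mk : Continuous fun y : EuclideanSpace ℝ (Fin k ⊕ Fin k) × ℝ =>
    (⟨y.1, y.2⟩ : Heisenberg k) := by
  refine continuous_iff_continuousAt.2 fun y₀ => tendsto_iff_dist_tendsto_zero.2 ?_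
  have h : Continuous fun y : EuclideanSpace ℝ (Fin k ⊕ Fin k) × ℝ =>
      dist (⟨y.1, y.2⟩ : Heisenberg k) ⟨y₀.1, y₀.2⟩ := by
    simp only [dist_eq, koranyi, mul_v, mul_t, inv_v, inv_t, sympl]
    fun_prop
  simpa using h.tendsto y₀

instance : TopologicalSpace.SeparableSpace (Heisenberg k) := by
  have hs : Function.Surjective fun y : EuclideanSpace ℝ (Fin k ⊕ Fin k) × ℝ =>
      (⟨y.1, y.2⟩ : Heisenberg k) := fun p => ⟨(p.v, p.t), rfl⟩
  exact hs.denseRange.separableSpace continuous_mk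

/-- The orthogonal complement `ν^⊥`, as an inner product space. -/
noncomputable abbrev Perp (ν : EuclideanSpace ℝ (Fin k ⊕ Fin k)) :
    Submodule ℝ (EuclideanSpace ℝ (Fin k ⊕ Fin k)) :=
  (ℝ ∙ ν)ᗮ

/-- The linear parametrization of the vertical subgroup `𝕎_ν` by `ν^⊥ × ℝ`. -/
noncomputable def toVert (ν : EuclideanSpace ℝ (Fin k ⊕ Fin k)) (y : Perp ν × ℝ) : Heisenberg k :=
  ⟨y.1, y.2⟩

theorem continuous_toVert (ν : EuclideanSpace ℝ (Fin k ⊕ Fin k)) : Continuous (toVert ν) :=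
  continuous_mk.comp (by fun_prop : Continuous fun y : Perp ν × ℝ =>
    ((y.1 : EuclideanSpace ℝ (Fin k ⊕ Fin k)), y.2))

theorem toVert_injective (ν : EuclideanSpace ℝ (Fin k ⊕ Fin k)) :
    Function.Injective (toVert ν) := fun y y' h => by
  have h1 := congrArg v h
  have h2 := congrArg t h
  exact Prod.ext (Subtype.ext h1) h2

theorem inner_perp {ν : EuclideanSpace ℝ (Fin k ⊕ Fin k)} (u : Perp ν) :
    inner ℝ (u : EuclideanSpace ℝ (Fin k ⊕ Fin k)) ν = (0 : ℝ) :=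
  Submodule.mem_orthogonal_singleton_iff_inner_left.1 u.2

theorem toVert_mem_vertical {ν : EuclideanSpace ℝ (Fin k ⊕ Fin k)} (y : Perp ν × ℝ) :
    toVert ν y ∈ vertical ν := inner_perp y.1

theorem sub_inner_smul_mem_perp {ν : EuclideanSpace ℝ (Fin k ⊕ Fin k)} (hν : ‖ν‖ = 1)
    (x : EuclideanSpace ℝ (Fin k ⊕ Fin k)) : x - (inner ℝ x ν : ℝ) • ν ∈ Perp ν := by
  rw [Submodule.mem_orthogonal_singleton_iff_inner_left, inner_sub_left, inner_smul_self hν,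
    sub_self]

/-- The map `w ↦ π_{𝕎_ν}(x · w)` of `𝕎_ν`, read in the parametrization `toVert`. -/
noncomputable def shear {ν : EuclideanSpace ℝ (Fin k ⊕ Fin k)} (hν : ‖ν‖ = 1) (x : Heisenberg k)
    (y : Perp ν × ℝ) : Perp ν × ℝ :=
  (y.1 + ⟨x.v - (inner ℝ x.v ν : ℝ) • ν, sub_inner_smul_mem_perp hν x.v⟩,
    y.2 + (x.t + sympl x.v y.1 / 2 - sympl (x.v + (y.1 : EuclideanSpace ℝ (Fin k ⊕ Fin k)))
      ((inner ℝ x.v ν : ℝ) • ν) / 2))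

theorem toVert_shear {ν : EuclideanSpace ℝ (Fin k ⊕ Fin k)} (hν : ‖ν‖ = 1) (x : Heisenberg k)
    (y : Perp ν × ℝ) : toVert ν (shear hν x y) = projV ν (x * toVert ν y) := by
  have h : inner ℝ (x.v + y.1) ν = (inner ℝ x.v ν : ℝ) := by
    rw [inner_add_left, inner_perp, add_zero]
  ext1
  · simp only [toVert, shear, projV, mul_v, h, Submodule.coe_add]
    abel
  · simp only [toVert, shear, projV, mul_v, mul_t, h]
    ring

theorem continuous_shear {ν : EuclideanSpace ℝ (Fin k ⊕ Fin k)} (hν : ‖ν‖ = 1)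
    (x : Heisenberg k) : Continuous (shear hν x) := by
  unfold shear sympl
  fun_prop

theorem shear_injective {ν : EuclideanSpace ℝ (Fin k ⊕ Fin k)} (hν : ‖ν‖ = 1)
    (x : Heisenberg k) : Function.Injective (shear hν x) := fun y y' h => by
  have h1 : y.1 = y'.1 := add_right_cancel (congrArg Prod.fst h)
  have h2 := congrArg Prod.snd h
  simp only [shear, h1, add_left_inj] at h2
  exact Prod.ext h1 h2

theorem measurePreserving_shear {ν : EuclideanSpace ℝ (Fin k ⊕ Fin k)} (hν : ‖ν‖ = 1)
    (x : Heisenberg k) : MeasurePreserving (shear hν x) :=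
  MeasurePreserving.skew_product (f := fun u : Perp ν => u + _)
    (g := fun u s => s + (x.t + sympl x.v u / 2 -
      sympl (x.v + (u : EuclideanSpace ℝ (Fin k ⊕ Fin k))) ((inner ℝ x.v ν : ℝ) • ν) / 2))
    (measurePreserving_add_right _ _)
    (by unfold sympl; exact Continuous.measurable (by fun_prop))
    (Filter.Eventually.of_forall fun u => (measurePreserving_add_right _ _).map_eq)

theorem volume_image_shear {ν : EuclideanSpace ℝ (Fin k ⊕ Fin k)} (hν : ‖ν‖ = 1)
    (x : Heisenberg k) {T : Set (Perp ν × ℝ)} (hT : IsCompact T) :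
    volume (shear hν x '' T) = volume T := by
  rw [← (measurePreserving_shear hν x).measure_preimage
    (hT.image (continuous_shear hν x)).measurableSet.nullMeasurableSet,
    preimage_image_eq _ (shear_injective hν x)]

theorem projV_of_mem_vertical {ν : EuclideanSpace ℝ (Fin k ⊕ Fin k)} (hν : ‖ν‖ = 1)
    {w : Heisenberg k} (hw : w ∈ vertical ν) : projV ν w = w := by
  simpa [horiz_zero] using projV_of_mul_horiz hν hw 0

/-- The vertical projection of `p · q` only depends on the vertical projection of `q`. -/
theorem projV_mul {ν : EuclideanSpace ℝ (Fin k ⊕ Fin k)} (hν : ‖ν‖ = 1) (p q : Heisenberg k) :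
    projV ν (p * projV ν q) = projV ν (p * q) := by
  have h : p * q = projV ν (p * projV ν q) *
      horiz ν (inner ℝ (p * projV ν q).v ν + inner ℝ q.v ν) := by
    rw [← horiz_mul_horiz, ← mul_assoc, projV_mul_horiz hν, mul_assoc, projV_mul_horiz hν]
  rw [h, projV_of_mul_horiz hν (projV_mem_vertical hν _)]

theorem finrank_perp {ν : EuclideanSpace ℝ (Fin k ⊕ Fin k)} (hν : ‖ν‖ = 1) :
    Module.finrank ℝ (Perp ν) + 2 = 2 * k + 1 := by
  have h0 : ν ≠ 0 := fun h => by simp [h] at hν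
  have h1 : Module.finrank ℝ (ℝ ∙ ν) + Module.finrank ℝ (Perp ν) = _ :=
    Submodule.finrank_add_finrank_orthogonal (ℝ ∙ ν)
  rw [finrank_span_singleton h0, finrank_euclideanSpace, Fintype.card_sum, Fintype.card_fin] at h1
  omega

theorem koranyi_le_of_le {p : Heisenberg k} {r : ℝ} (hr : 0 ≤ r) (hv : ‖p.v‖ ≤ r / 2)
    (ht : |p.t| ≤ r ^ 2 / 8) : koranyi p ≤ r := by
  refine le_of_pow_le_pow_left₀ four_ne_zero hr ?_
  rw [koranyi_pow_four]
  have h1 := pow_le_pow_left₀ (norm_nonneg _) hv 4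
  have h2 := pow_le_pow_left₀ (abs_nonneg _) ht 2
  rw [sq_abs] at h2
  have : 0 ≤ r ^ 4 := by positivity
  nlinarith

theorem abs_t_le {p : Heisenberg k} {r : ℝ} (hr : koranyi p ≤ r) : |p.t| ≤ r ^ 2 / 4 := by
  have h0 := koranyi_nonneg p
  refine abs_le_of_sq_le_sq ?_ (by positivity)
  have h1 := pow_le_pow_left₀ h0 hr 4
  rw [koranyi_pow_four] at h1
  have : 0 ≤ ‖p.v‖ ^ 4 := by positivity
  nlinarith

theorem ofReal_pow_mul_eq {r : ℝ} (hr : 0 ≤ r) {n : ℕ} (hn : n + 2 = 2 * k + 1) (c : ℝ)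
    (κ : ℝ≥0∞) :
    ENNReal.ofReal (r ^ n) * κ * ENNReal.ofReal (c * r ^ 2) =
      ENNReal.ofReal (c * r ^ (2 * k + 1)) * κ := by
  rw [mul_right_comm, ← ENNReal.ofReal_mul (by positivity), ← hn]
  congr 2
  ring

/-- Lower bound for the Lebesgue measure of the Korányi balls of `𝕎_ν`. -/
theorem le_volume_preimage_closedBall {ν : EuclideanSpace ℝ (Fin k ⊕ Fin k)} (hν : ‖ν‖ = 1)
    {w : Heisenberg k} (hw : w ∈ range (toVert ν)) {r : ℝ} (hr : 0 ≤ r) :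
    ENNReal.ofReal ((r / 2) ^ (2 * k + 1)) * volume (Metric.closedBall (0 : Perp ν) 1) ≤
      volume (toVert ν ⁻¹' Metric.closedBall w r) := by
  obtain ⟨y₀, rfl⟩ := hw
  rw [← (measurePreserving_shear hν (toVert ν y₀)).measure_preimage
    ((continuous_toVert ν).measurable Metric.isClosed_closedBall.measurableSet).nullMeasurableSet]
  have hsub : Metric.closedBall (0 : Perp ν) (r / 2) ×ˢ Icc (-(r ^ 2 / 8)) (r ^ 2 / 8) ⊆
      shear hν (toVert ν y₀) ⁻¹' (toVert ν ⁻¹' Metric.closedBall (toVert ν y₀) r) := by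
    rintro y ⟨h1, h2⟩
    have hmem : toVert ν y₀ * toVert ν y ∈ vertical ν := by
      change inner ℝ _ ν = (0 : ℝ)
      rw [inner_mul_v, toVert_mem_vertical y₀, toVert_mem_vertical y, add_zero]
    rw [mem_preimage, mem_preimage, toVert_shear, Metric.mem_closedBall, dist_eq,
      projV_of_mem_vertical hν hmem, inv_mul_cancel_left]
    rw [mem_closedBall_zero_iff] at h1
    exact koranyi_le_of_le hr h1 (abs_le.2 h2)
  refine le_trans (le_of_eq ?_) (measure_mono hsub)
  rw [Measure.volume_eq_prod, Measure.prod_prod,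
    Measure.addHaar_closedBall' _ _ (by positivity : 0 ≤ r / 2),
    Real.volume_Icc, show r ^ 2 / 8 - -(r ^ 2 / 8) = 1 * (r / 2) ^ 2 by ring,
    ofReal_pow_mul_eq (by positivity) (finrank_perp hν), one_mul]

theorem volume_closedBall_ne_zero (ν : EuclideanSpace ℝ (Fin k ⊕ Fin k)) :
    volume (Metric.closedBall (0 : Perp ν) 1) ≠ 0 :=
  (Metric.measure_closedBall_pos _ _ one_pos).ne'

theorem volume_closedBall_ne_top (ν : EuclideanSpace ℝ (Fin k ⊕ Fin k)) :
    volume (Metric.closedBall (0 : Perp ν) 1) ≠ ⊤ :=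
  measure_closedBall_lt_top.ne

/-- The exponent of `hausdorff k` as a natural number power. -/
theorem rpow_dim (x : ℝ≥0∞) : x ^ (2 * k + 1 : ℝ) = x ^ (2 * k + 1) := by
  rw [← ENNReal.rpow_natCast]; push_cast; rfl

/-- The Hausdorff measure on `𝕎_ν` is bounded by a multiple of Lebesgue measure. The constant
depends on `ν` only through the volume of the unit ball of `ν^⊥`. -/
theorem hausdorff_image_toVert_le {ν : EuclideanSpace ℝ (Fin k ⊕ Fin k)} (hν : ‖ν‖ = 1)
    {A : Set (Perp ν × ℝ)} (hA : IsCompact A) :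
    hausdorff k (toVert ν '' A) ≤
      ENNReal.ofReal (16 ^ (2 * k + 1)) / volume (Metric.closedBall (0 : Perp ν) 1) *
        volume A := by
  set κ := volume (Metric.closedBall (0 : Perp ν) 1)
  have hκ0 : κ ≠ 0 := volume_closedBall_ne_zero ν
  have hκt : κ ≠ ⊤ := volume_closedBall_ne_top ν
  set μ : Measure (Heisenberg k) := Measure.map (toVert ν) volume
  have hmeas := (continuous_toVert ν).measurable
  have hcomp := hA.image (continuous_toVert ν)
  set K := toVert ν '' A
  have hμK : μ K = volume A := by
    rw [Measure.map_apply hmeas hcomp.isClosed.measurableSet,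
      preimage_image_eq _ (toVert_injective ν)]
  have hfin : μ (Metric.cthickening 1 K) ≠ ⊤ := by
    obtain ⟨R, hR⟩ := (hcomp.isBounded.cthickening (δ := 1)).subset_closedBall (1 : Heisenberg k)
    refine ((measure_mono hR).trans_lt ?_).ne
    rw [Measure.map_apply hmeas Metric.isClosed_closedBall.measurableSet]
    refine lt_of_le_of_lt (measure_mono (t := Metric.closedBall (0 : Perp ν) R ×ˢ
      Icc (-(R ^ 2 / 4)) (R ^ 2 / 4)) ?_) ?_
    · intro y hy
      rw [mem_preimage, Metric.mem_closedBall, dist_eq, inv_one, one_mul] at hy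
      refine mem_prod.2 ⟨?_, abs_le.1 (abs_t_le hy)⟩
      rw [mem_closedBall_zero_iff]
      exact (norm_v_le_koranyi (toVert ν y)).trans hy
    · rw [Measure.volume_eq_prod, Measure.prod_prod]
      exact ENNReal.mul_lt_top measure_closedBall_lt_top (by simp)
  -- Cover `K` by balls of radius `4ρ` with centres in `K` whose concentric `ρ`-balls are disjoint;
  -- the `ρ`-balls lie in the `ρ`-neighbourhood of `K`, whose measure tends to that of `K`.
  let ρ : ℕ → ℝ := fun n => 1 / ((n : ℝ) + 1)
  have hρ : ∀ n, 0 < ρ n := fun n => Nat.one_div_pos_of_nat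
  have hρ0 : Filter.Tendsto ρ Filter.atTop (nhds 0) := tendsto_one_div_add_atTop_nhds_zero_nat
  have hV : ∀ n, ∃ u ⊆ K, (u.PairwiseDisjoint fun a => Metric.closedBall a (ρ n)) ∧
      ∀ a ∈ K, ∃ b ∈ u, Metric.closedBall a (ρ n) ⊆ Metric.closedBall b (4 * ρ n) := fun n =>
    Vitali.exists_disjoint_subfamily_covering_enlargement_closedBall K id (fun _ => ρ n) (ρ n)
      (fun _ _ => le_rfl) 4 (by norm_num)
  choose u huK hud hucov using hV
  have hcount : ∀ n, Countable (u n) := fun n =>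
    ((hud n).countable_of_nonempty_interior fun a _ =>
      ⟨a, mem_interior_iff_mem_nhds.2 (Metric.closedBall_mem_nhds a (hρ n))⟩).to_subtype
  have hdiam : ∀ n (a : Heisenberg k),
      Metric.ediam (Metric.closedBall a (4 * ρ n)) ≤ ENNReal.ofReal (8 * ρ n) := fun n a => by
    refine Metric.ediam_le fun x hx y hy => ?_
    rw [edist_dist]
    refine ENNReal.ofReal_le_ofReal ?_
    have := dist_triangle_right x y a
    rw [Metric.mem_closedBall] at hx hy
    linarith
  have hH : hausdorff k K ≤ Filter.liminf (fun n => ∑' i : u n,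
      Metric.ediam (Metric.closedBall (i : Heisenberg k) (4 * ρ n)) ^ (2 * k + 1 : ℝ))
      Filter.atTop := by
    refine Measure.hausdorffMeasure_le_liminf_tsum _ K (fun n => ENNReal.ofReal (8 * ρ n)) ?_
      (fun n (i : u n) => Metric.closedBall (i : Heisenberg k) (4 * ρ n))
      (Filter.Eventually.of_forall fun n i => hdiam n i) (Filter.Eventually.of_forall fun n => ?_)
    · have := ENNReal.tendsto_ofReal (hρ0.const_mul 8)
      simpa using this
    · intro a ha
      obtain ⟨b, hb, hab⟩ := hucov n a ha
      exact mem_iUnion.2 ⟨⟨b, hb⟩, hab (Metric.mem_closedBall_self (hρ n).le)⟩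
  have hterm : ∀ n, ∑' i : u n,
      Metric.ediam (Metric.closedBall (i : Heisenberg k) (4 * ρ n)) ^ (2 * k + 1 : ℝ) ≤
        ENNReal.ofReal (16 ^ (2 * k + 1)) / κ * μ (Metric.cthickening (ρ n) K) := fun n => by
    calc _ ≤ ∑' i : u n, ENNReal.ofReal (16 ^ (2 * k + 1)) / κ *
          μ (Metric.closedBall (i : Heisenberg k) (ρ n)) := by
          refine ENNReal.tsum_le_tsum fun i => ?_
          have h1 := le_volume_preimage_closedBall hν
            (image_subset_range _ _ (huK n i.2)) (hρ n).le
          rw [← Measure.map_apply hmeas Metric.isClosed_closedBall.measurableSet] at h1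
          rw [rpow_dim]
          refine (pow_le_pow_left' (hdiam n i) _).trans ?_
          refine le_trans (le_of_eq ?_) (mul_le_mul_right h1 _)
          rw [← ENNReal.ofReal_pow (by have := hρ n; positivity),
            show ENNReal.ofReal (16 ^ (2 * k + 1)) / κ *
              (ENNReal.ofReal ((ρ n / 2) ^ (2 * k + 1)) * κ) =
              ENNReal.ofReal (16 ^ (2 * k + 1)) * ENNReal.ofReal ((ρ n / 2) ^ (2 * k + 1)) *
                (κ / κ) by simp only [div_eq_mul_inv]; ring,
            ENNReal.div_self hκ0 hκt, mul_one, ← ENNReal.ofReal_mul (by positivity), ← mul_pow]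
          congr 2; ring
      _ ≤ _ := by
          rw [ENNReal.tsum_mul_left]
          gcongr
          refine (tsum_meas_le_meas_iUnion_of_disjoint μ
            (fun i : u n => Metric.isClosed_closedBall.measurableSet)
            ((hud n).subtype _ _)).trans (measure_mono (iUnion_subset fun i => ?_))
          exact Metric.closedBall_subset_cthickening (huK n i.2) _
  have hlim : Filter.Tendsto (fun n => ENNReal.ofReal (16 ^ (2 * k + 1)) / κ *
      μ (Metric.cthickening (ρ n) K)) Filter.atTop
      (nhds (ENNReal.ofReal (16 ^ (2 * k + 1)) / κ * μ K)) := by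
    refine ENNReal.Tendsto.const_mul ?_ (Or.inr (ENNReal.div_ne_top ENNReal.ofReal_ne_top hκ0))
    exact (tendsto_measure_cthickening_of_isClosed ⟨1, one_pos, hfin⟩ hcomp.isClosed).comp hρ0
  rw [← hμK]
  exact (hH.trans (Filter.liminf_le_liminf (Filter.Eventually.of_forall hterm))).trans_eq
    hlim.liminf_eq

/-- Vertical projections of subsets of `B(x, r)`, with the horizontal part of the projected set
confined to a translate of a compact set `T`. The translation `x` has no influence on the bound
because the maps `shear` preserve Lebesgue measure. -/
theorem hausdorff_image_projV_le {ν : EuclideanSpace ℝ (Fin k ⊕ Fin k)} (hν : ‖ν‖ = 1)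
    {T : Set (Perp ν)} (hT : IsCompact T) {r : ℝ} (x : Heisenberg k)
    {S : Set (Heisenberg k)} (hS : ∀ q ∈ S, koranyi (x⁻¹ * q) ≤ r)
    (hST : ∀ q ∈ S, ∀ u : Perp ν, (projV ν (x⁻¹ * q)).v = u → u ∈ T) :
    hausdorff k (projV ν '' S) ≤
      ENNReal.ofReal (16 ^ (2 * k + 1)) / volume (Metric.closedBall (0 : Perp ν) 1) *
        (volume T * ENNReal.ofReal (2 * r ^ 2)) := by
  have hTc : IsCompact (T ×ˢ Icc (-r ^ 2) (r ^ 2)) := hT.prod isCompact_Icc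
  have hsub : projV ν '' S ⊆ toVert ν '' (shear hν x '' (T ×ˢ Icc (-r ^ 2) (r ^ 2))) := by
    rintro _ ⟨q, hq, rfl⟩
    set z := x⁻¹ * q with hz
    have hzr := hS q hq
    refine ⟨_, ⟨(⟨(projV ν z).v, sub_inner_smul_mem_perp hν z.v⟩, (projV ν z).t),
      ⟨?_, ?_⟩, rfl⟩, ?_⟩
    · exact hST q hq _ rfl
    · rw [neg_eq_neg_one_mul]
      simp only [mem_Icc, neg_one_mul, ← abs_le]
      have h1 := abs_t_le hzr
      have h2 := abs_real_inner_le_norm z.v ν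
      have h3 := abs_sympl_le z.v ν
      have h4 : ‖z.v‖ ≤ r := (norm_v_le_koranyi z).trans hzr
      rw [hν, mul_one] at h2 h3
      simp only [projV, sympl_smul_right]
      refine (abs_sub _ _).trans ?_
      rw [abs_div, abs_mul, abs_two]
      have h5 : |(inner ℝ z.v ν : ℝ)| * |sympl z.v ν| ≤ r * r := by
        gcongr
        · exact (norm_nonneg _).trans h4
        · exact h2.trans h4
        · exact h3.trans h4
      nlinarith [sq_nonneg r]
    · rw [toVert_shear]
      change projV ν (x * projV ν z) = _
      rw [projV_mul hν, hz, mul_inv_cancel_left]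
  refine (measure_mono hsub).trans
    ((hausdorff_image_toVert_le hν (hTc.image (continuous_shear hν x))).trans ?_)
  rw [volume_image_shear hν x hTc, Measure.volume_eq_prod, Measure.prod_prod, Real.volume_Icc]
  gcongr
  exact le_of_eq (by ring)

theorem const_mul_volume_eq {ν : EuclideanSpace ℝ (Fin k ⊕ Fin k)} (hν : ‖ν‖ = 1) {r : ℝ}
    (hr : 0 ≤ r) :
    ENNReal.ofReal (16 ^ (2 * k + 1)) / volume (Metric.closedBall (0 : Perp ν) 1) *
        (volume (Metric.closedBall (0 : Perp ν) (2 * r)) * ENNReal.ofReal (2 * r ^ 2)) =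
      ENNReal.ofReal (32 ^ (2 * k + 1) / 2 * r ^ (2 * k + 1)) := by
  set κ := volume (Metric.closedBall (0 : Perp ν) 1) with hκ
  rw [Measure.addHaar_closedBall' _ _ (by positivity), ← hκ,
    show 2 * r ^ 2 = 1 / 2 * (2 * r) ^ 2 by ring,
    ofReal_pow_mul_eq (by positivity) (finrank_perp hν), mul_comm _ κ, ← mul_assoc,
    ENNReal.div_mul_cancel (volume_closedBall_ne_zero ν) (volume_closedBall_ne_top ν),
    ← ENNReal.ofReal_mul (by positivity), show (32 : ℝ) = 16 * 2 by norm_num, mul_pow, mul_pow]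
  congr 1; ring

theorem norm_sub_inner_smul_le {ν : EuclideanSpace ℝ (Fin k ⊕ Fin k)} (hν : ‖ν‖ = 1)
    (x : EuclideanSpace ℝ (Fin k ⊕ Fin k)) : ‖x - (inner ℝ x ν : ℝ) • ν‖ ≤ ‖x‖ := by
  refine le_of_sq_le_sq ?_ (norm_nonneg _)
  rw [norm_sub_sq_real, norm_smul, hν, real_inner_smul_right, mul_one, Real.norm_eq_abs, sq_abs]
  nlinarith [sq_nonneg (inner ℝ x ν : ℝ)]

/-- Vertical projections of balls of radius `r` have measure at most comparable to
`r ^ (2k+1)`. -/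
theorem hausdorff_projV_closedBall_le {ν : EuclideanSpace ℝ (Fin k ⊕ Fin k)} (hν : ‖ν‖ = 1)
    (x : Heisenberg k) {r : ℝ} (hr : 0 ≤ r) :
    hausdorff k (projV ν '' Metric.closedBall x r) ≤
      ENNReal.ofReal (32 ^ (2 * k + 1) * r ^ (2 * k + 1)) := by
  refine (hausdorff_image_projV_le hν (isCompact_closedBall (0 : Perp ν) (2 * r)) x
    (r := r) (fun q hq => hq) fun q hq u hu => ?_).trans ?_
  · rw [mem_closedBall_zero_iff]
    have h1 := (norm_sub_inner_smul_le hν (x⁻¹ * q).v).trans (norm_v_le_koranyi (x⁻¹ * q))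
    have h2 : koranyi (x⁻¹ * q) ≤ r := hq
    change ‖(u : EuclideanSpace ℝ (Fin k ⊕ Fin k))‖ ≤ _
    rw [← hu]
    exact (h1.trans h2).trans (by linarith)
  · rw [const_mul_volume_eq hν hr]
    refine ENNReal.ofReal_le_ofReal ?_
    gcongr
    exact div_le_self (by positivity) (by norm_num)

/-- A slab of relative thickness `1 / (4N)` in the ball of radius `r` takes up at most the `N`-th
part of the ball of radius `2r`, because `N` disjoint translates of the slab fit in there. -/
theorem mul_volume_slab_le {V : Type*} [NormedAddCommGroup V] [InnerProductSpace ℝ V]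
    [FiniteDimensional ℝ V] [MeasurableSpace V] [BorelSpace V] {g : V} (hg1 : ‖g‖ ≤ 1)
    (hg : 1 / 2 < ‖g‖ ^ 2) {N : ℕ} (hN : 0 < N) {r : ℝ} (hr : 0 < r) :
    (N : ℝ≥0∞) * volume {u : V | ‖u‖ ≤ r ∧ |inner ℝ u g| ≤ r / (4 * N)} ≤
      volume (Metric.closedBall (0 : V) (2 * r)) := by
  set A := {u : V | ‖u‖ ≤ r ∧ |inner ℝ u g| ≤ r / (4 * N)}
  have hNR : (0 : ℝ) < N := by exact_mod_cast hN
  have hA : MeasurableSet A :=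
    ((isClosed_le continuous_norm continuous_const).inter
      (isClosed_le (by fun_prop : Continuous fun u : V => |inner ℝ u g|)
        continuous_const)).measurableSet
  let c : Fin N → V := fun i => (r * (i / N)) • g
  let B : Fin N → Set V := fun i => (fun u => u + -c i) ⁻¹' A
  have hB : ∀ i, volume (B i) = volume A := fun i => measure_preimage_add_right _ _ _
  have hBm : ∀ i, MeasurableSet (B i) := fun i => measurable_add_const _ hA
  have hlt : ∀ i j : Fin N, i < j → Disjoint (B i) (B j) := by
    intro i j hij
    rw [Set.disjoint_left]
    rintro u ⟨-, h1⟩ ⟨-, h2⟩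
    simp only [c, ← sub_eq_add_neg, inner_sub_left, real_inner_smul_left,
      real_inner_self_eq_norm_sq] at h1 h2
    rw [abs_le] at h1 h2
    have hij' : (i : ℝ) + 1 ≤ j := by exact_mod_cast hij
    have h3 : r * (i / N) * ‖g‖ ^ 2 + r / N * ‖g‖ ^ 2 ≤ r * (j / N) * ‖g‖ ^ 2 := by
      rw [← add_mul]
      gcongr
      calc r * (i / N) + r / N = r * ((i + 1) / N) := by ring
        _ ≤ _ := by gcongr
    have h4 : r / N * (1 / 2) < r / N * ‖g‖ ^ 2 := by gcongr
    have h5 : r / N * (1 / 2) = r / (4 * N) + r / (4 * N) := by field_simp; norm_num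
    linarith [h1.2, h2.1]
  have hdisj : Pairwise (Function.onFun Disjoint B) := fun i j hij =>
    (lt_or_gt_of_ne hij).elim (hlt i j) fun h => (hlt j i h).symm
  have hsub : ⋃ i, B i ⊆ Metric.closedBall 0 (2 * r) := by
    refine iUnion_subset fun i u hu => ?_
    rw [mem_closedBall_zero_iff]
    have h1 : ‖c i‖ ≤ r := by
      rw [norm_smul, Real.norm_eq_abs, abs_of_nonneg (by positivity)]
      have : (i : ℝ) / N ≤ 1 := by
        rw [div_le_one hNR]; exact_mod_cast i.2.le
      calc r * (i / N) * ‖g‖ ≤ r * 1 * 1 := by gcongr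
        _ = r := by ring
    calc ‖u‖ = ‖(u + -c i) + c i‖ := by rw [neg_add_cancel_right]
      _ ≤ ‖u + -c i‖ + ‖c i‖ := norm_add_le _ _
      _ ≤ 2 * r := by linarith [hu.1]
  have := (tsum_meas_le_meas_iUnion_of_disjoint volume hBm hdisj).trans (measure_mono hsub)
  simpa [hB] using this

/-- If `E ∩ B(x, r)` is close to a vertical hyperplane with normal `ν'` almost orthogonal to
`ν`, then its vertical projection to `𝕎_ν` has small measure. -/
theorem hausdorff_projV_le_of_inner_le {ν ν' : EuclideanSpace ℝ (Fin k ⊕ Fin k)} (hν : ‖ν‖ = 1)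
    (hν' : ‖ν'‖ = 1) {N : ℕ} (hN : 0 < N) (hνν' : |(inner ℝ ν ν' : ℝ)| ≤ 1 / (8 * N))
    {r : ℝ} (hr : 0 < r) (x : Heisenberg k) {S : Set (Heisenberg k)}
    (hS : ∀ q ∈ S, dist q x ≤ r)
    (hS' : ∀ q ∈ S, |(inner ℝ (x⁻¹ * q).v ν' : ℝ)| ≤ r / (8 * N)) :
    hausdorff k (projV ν '' S) ≤
      ENNReal.ofReal (32 ^ (2 * k + 1) / N * r ^ (2 * k + 1)) := by
  have hNR : (1 : ℝ) ≤ N := by exact_mod_cast hN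
  have hNE : (N : ℝ≥0∞) ≠ 0 := by exact_mod_cast hN.ne'
  set g : Perp ν := ⟨ν' - (inner ℝ ν' ν : ℝ) • ν, sub_inner_smul_mem_perp hν ν'⟩ with hg
  have hgin : ∀ u : Perp ν, inner ℝ u g = (inner ℝ (u : EuclideanSpace ℝ _) ν' : ℝ) := fun u => by
    rw [Submodule.coe_inner, hg, inner_sub_right, real_inner_smul_right, inner_perp, mul_zero,
      sub_zero]
  have hg1 : ‖g‖ ≤ 1 := (norm_sub_inner_smul_le hν ν').trans_eq hν'
  have h8 : |(inner ℝ ν ν' : ℝ)| ≤ 1 / 8 := hνν'.trans (by gcongr; linarith)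
  have hg2 : 1 / 2 < ‖g‖ ^ 2 := by
    have h1 : ‖g‖ ^ 2 = 1 - (inner ℝ ν ν' : ℝ) ^ 2 := by
      rw [← real_inner_self_eq_norm_sq, hgin, hg, inner_sub_left, real_inner_smul_left,
        real_inner_self_eq_norm_sq, hν', real_inner_comm ν ν']; ring
    rw [h1, ← sq_abs]
    nlinarith [abs_nonneg (inner ℝ ν ν' : ℝ)]
  set T := {u : Perp ν | ‖u‖ ≤ r ∧ |inner ℝ u g| ≤ r / (4 * N)} with hTdef
  have hT : IsCompact T := by
    refine (isCompact_closedBall (0 : Perp ν) r).of_isClosed_subset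
      ((isClosed_le continuous_norm continuous_const).inter
      (isClosed_le (by fun_prop : Continuous fun u : Perp ν => |inner ℝ u g|)
        continuous_const)) fun u hu => mem_closedBall_zero_iff.2 hu.1
  have hvol : volume T ≤ (N : ℝ≥0∞)⁻¹ * volume (Metric.closedBall (0 : Perp ν) (2 * r)) := by
    rw [← ENNReal.mul_le_iff_le_inv hNE (by simp)]
    exact mul_volume_slab_le hg1 hg2 hN hr
  refine (hausdorff_image_projV_le hν hT x (r := r) hS fun q hq u hu => ?_).trans ?_
  · have hz : koranyi (x⁻¹ * q) ≤ r := hS q hq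
    have hzv := (norm_v_le_koranyi (x⁻¹ * q)).trans hz
    refine ⟨?_, ?_⟩
    · change ‖(u : EuclideanSpace ℝ (Fin k ⊕ Fin k))‖ ≤ _
      rw [← hu]
      exact (norm_sub_inner_smul_le hν _).trans hzv
    · rw [hgin, ← hu]
      simp only [projV, inner_sub_left, real_inner_smul_left]
      refine (abs_sub _ _).trans ?_
      have h1 := abs_real_inner_le_norm (x⁻¹ * q).v ν
      rw [hν, mul_one] at h1
      have h2 : |(inner ℝ (x⁻¹ * q).v ν : ℝ) * inner ℝ ν ν'| ≤ r * (1 / (8 * N)) := by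
        rw [abs_mul]; gcongr; exact h1.trans hzv
      have h3 : r / (4 * N) = r / (8 * N) + r * (1 / (8 * N)) := by field_simp; norm_num
      linarith [hS' q hq]
  · calc _ ≤ ENNReal.ofReal (16 ^ (2 * k + 1)) / volume (Metric.closedBall (0 : Perp ν) 1) *
          ((N : ℝ≥0∞)⁻¹ * volume (Metric.closedBall (0 : Perp ν) (2 * r)) *
            ENNReal.ofReal (2 * r ^ 2)) := by gcongr
      _ = (N : ℝ≥0∞)⁻¹ * ENNReal.ofReal (32 ^ (2 * k + 1) / 2 * r ^ (2 * k + 1)) := by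
          rw [← const_mul_volume_eq hν hr.le]; ring
      _ ≤ _ := by
          rw [← ENNReal.ofReal_natCast, ← ENNReal.ofReal_inv_of_pos (by linarith),
            ← ENNReal.ofReal_mul (by positivity)]
          refine ENNReal.ofReal_le_ofReal ?_
          rw [← mul_assoc, div_eq_inv_mul (_ : ℝ) (N : ℝ)]
          gcongr
          exact div_le_self (by positivity) (by norm_num)

/-- Vertical projections increase the `(2k+1)`-dimensional Hausdorff measure at most by a constant
factor, although they are not Lipschitz. -/
theorem hausdorff_projV_le {ν : EuclideanSpace ℝ (Fin k ⊕ Fin k)} (hν : ‖ν‖ = 1)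
    (A : Set (Heisenberg k)) :
    hausdorff k (projV ν '' A) ≤ ENNReal.ofReal (32 ^ (2 * k + 1)) * hausdorff k A := by
  set C := ENNReal.ofReal (32 ^ (2 * k + 1)) with hC
  have hC0 : C ≠ 0 := by rw [hC, Ne, ENNReal.ofReal_eq_zero, not_le]; positivity
  have hCt : C ≠ ⊤ := ENNReal.ofReal_ne_top
  -- Any outer measure dominated by `diam ^ (2k+1)` on small sets is dominated by `hausdorff k`.
  have key : C⁻¹ • OuterMeasure.comap (projV ν) (hausdorff k).toOuterMeasure ≤
      OuterMeasure.mkMetric fun d : ℝ≥0∞ => d ^ (2 * k + 1 : ℝ) := by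
    refine OuterMeasure.le_mkMetric _ _ 1 one_pos fun s hs => ?_
    rw [_root_.smul_apply, OuterMeasure.comap_apply, smul_eq_mul, mul_comm,
      ← div_eq_mul_inv]
    refine ENNReal.div_le_of_le_mul' ?_
    rcases s.eq_empty_or_nonempty with rfl | ⟨x, hx⟩
    · simp
    have hfin : Metric.ediam s ≠ ⊤ := (hs.trans_lt ENNReal.one_lt_top).ne
    have hsub : s ⊆ Metric.closedBall x (Metric.ediam s).toReal := fun y hy => by
      rw [Metric.mem_closedBall, ← ENNReal.ofReal_le_ofReal_iff ENNReal.toReal_nonneg,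
        ENNReal.ofReal_toReal hfin, ← edist_dist]
      exact Metric.edist_le_ediam_of_mem hy hx
    refine (measure_mono (image_mono hsub)).trans
      ((hausdorff_projV_closedBall_le hν x ENNReal.toReal_nonneg).trans_eq ?_)
    rw [ENNReal.ofReal_mul (by positivity), ENNReal.ofReal_pow ENNReal.toReal_nonneg,
      ENNReal.ofReal_toReal hfin, rpow_dim]
  have h := key A
  rw [_root_.smul_apply, OuterMeasure.comap_apply, smul_eq_mul,
    ← Measure.mkMetric_toOuterMeasure, mul_comm, ← div_eq_mul_inv,
    ENNReal.div_le_iff' hC0 hCt] at h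
  exact h

end Heisenberg

/-! ### Colourings and random selection of colours -/

/-- A set in which separated families in balls have bounded cardinality can be covered by boundedly
many open sets in each of which no distance lies in `(r/2, r]`. The sets are
neighbourhoods of separated nets, each net chosen in what the previous ones leave uncovered. -/
theorem exists_open_cover_forall_dist_le_half {X : Type*} [PseudoMetricSpace X] (S : Set X) {r : ℝ}
    (hr : 0 < r) {Q : ℕ}
    (hQ : ∀ x ∈ S, ∀ z : Fin Q → X, (∀ i, z i ∈ S) → (∀ i, dist x (z i) ≤ 8 * r) →
      ∃ i j, i < j ∧ dist (z j) (z i) < r / 4) :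
    ∃ C : Fin Q → Set X, (∀ i, IsOpen (C i)) ∧ (∀ x ∈ S, ∃ i, x ∈ C i) ∧
      ∀ i, ∀ x ∈ C i, ∀ y ∈ C i, dist x y ≤ r → dist x y ≤ r / 2 := by
  have hnet : ∀ A : Set X, ∃ u ⊆ A,
      (u.PairwiseDisjoint fun a => Metric.closedBall a (2 * r)) ∧
      ∀ a ∈ A, ∃ b ∈ u, Metric.closedBall a (2 * r) ⊆ Metric.closedBall b (4 * (2 * r)) :=
    fun A => Vitali.exists_disjoint_subfamily_covering_enlargement_closedBall A id
      (fun _ => 2 * r) (2 * r) (fun _ _ => le_rfl) 4 (by norm_num)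
  choose net hnetsub hnetd hnetcov using hnet
  -- `T n` is what remains to be covered after `n` steps.
  let T : ℕ → Set X := fun n => Nat.rec S (fun _ A => A \ Metric.thickening (r / 4) (net A)) n
  have hTsucc : ∀ n, T (n + 1) = T n \ Metric.thickening (r / 4) (net (T n)) := fun n => rfl
  have hTanti : Antitone T := antitone_nat_of_succ_le fun n => by
    rw [hTsucc]; exact sdiff_subset
  refine ⟨fun i => Metric.thickening (r / 4) (net (T i)), fun i => Metric.isOpen_thickening,
    fun x hx => ?_, fun i x hx y hy hxy => ?_⟩
  · by_contra! hnot
    have hxT : ∀ n, n ≤ Q → x ∈ T n := by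
      intro n
      induction n with
      | zero => exact fun _ => hx
      | succ n ih => exact fun h => ⟨ih (by omega), hnot ⟨n, by omega⟩⟩
    have hz : ∀ i : Fin Q, ∃ z ∈ net (T i), dist x z ≤ 8 * r := fun i => by
      obtain ⟨b, hb, hsub⟩ := hnetcov (T i) x (hxT i i.2.le)
      have := hsub (Metric.mem_closedBall_self (by positivity))
      exact ⟨b, hb, by rw [Metric.mem_closedBall] at this; linarith⟩
    choose z hz hxz using hz
    obtain ⟨i, j, hij, hd⟩ := hQ x hx z (fun i => hTanti (Nat.zero_le i) (hnetsub _ (hz i))) hxz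
    have h1 : z j ∈ T (i + 1) := hTanti (by exact_mod_cast hij) (hnetsub _ (hz j))
    exact h1.2 (Metric.mem_thickening_iff.2 ⟨z i, hz i, hd⟩)
  · obtain ⟨a, ha, hxa⟩ := Metric.mem_thickening_iff.1 hx
    obtain ⟨b, hb, hyb⟩ := Metric.mem_thickening_iff.1 hy
    have hab : a = b := by
      by_contra hne
      refine Set.disjoint_left.1 (hnetd _ ha hb hne)
        (Metric.mem_closedBall_self (by positivity)) ?_
      have h1 := dist_triangle4 a x y b
      rw [Metric.mem_closedBall]
      linarith [dist_comm x a]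
    subst hab
    linarith [dist_triangle_right x y a]

/-- Random choice of one colour at every scale. If almost every point sees each colouring and has
at most `N` bad scales, then for some choice `ξ` of colours, a proportion of at least `Q ^ (-N)` of
the points carries the colour `ξ j` at each of its bad scales `j`. -/
theorem exists_colour_sequence {X : Type*} [MeasurableSpace X] (μ : Measure X) [IsFiniteMeasure μ]
    {Q : ℕ} (hQ : 0 < Q) {N : ℕ} {Bad : ℕ → Set X} (hBad : ∀ j, MeasurableSet (Bad j))
    {C : ℕ → Fin Q → Set X} (hC : ∀ j i, MeasurableSet (C j i))
    (hcov : ∀ᵐ x ∂μ, ∀ j, ∃ i, x ∈ C j i) (hN : ∀ᵐ x ∂μ, {j | x ∈ Bad j}.encard ≤ N) :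
    ∃ ξ : ℕ → Fin Q, μ univ * ((Q : ℝ≥0∞)⁻¹) ^ N ≤
      μ {x | ∀ j, x ∈ Bad j → x ∈ C j (ξ j)} := by
  have : NeZero Q := ⟨hQ.ne'⟩
  let P : Measure (Fin Q) := (PMF.uniformOfFintype (Fin Q)).toMeasure
  have hP : ∀ i, P {i} = (Q : ℝ≥0∞)⁻¹ := fun i => by
    simp only [P]
    rw [PMF.toMeasure_apply_singleton _ _ (measurableSet_singleton i)]
    simp
  let ℙ : Measure (ℕ → Fin Q) := Measure.infinitePi fun _ => P
  let D : Set (X × (ℕ → Fin Q)) := {y | ∀ j, y.1 ∈ Bad j → y.1 ∈ C j (y.2 j)}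
  have hD : MeasurableSet D := by
    have : D = ⋂ j, ((Bad j)ᶜ ×ˢ univ ∪ ⋃ i, C j i ×ˢ {ξ | ξ j = i}) := by
      ext y
      simp only [D, mem_ofPred_eq, mem_iInter, mem_union, mem_prod, mem_compl_iff, mem_univ,
        and_true, mem_iUnion, exists_eq_right', imp_iff_not_or]
    rw [this]
    refine MeasurableSet.iInter fun j => ((hBad j).compl.prod .univ).union
      (MeasurableSet.iUnion fun i => (hC j i).prod ?_)
    exact measurableSet_eq_fun (measurable_pi_apply j) measurable_const
  have hsec : ∀ᵐ x ∂μ, ((Q : ℝ≥0∞)⁻¹) ^ N ≤ ℙ (Prod.mk x ⁻¹' D) := by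
    filter_upwards [hcov, hN] with x hx hxN
    choose i hi using hx
    have hfin : {j | x ∈ Bad j}.Finite := Set.finite_of_encard_le_coe hxN
    have hcard : hfin.toFinset.card ≤ N := by
      rw [hfin.encard_eq_coe_toFinset_card] at hxN
      exact_mod_cast hxN
    have hsub : Set.pi (hfin.toFinset : Set ℕ) (fun j => {i j}) ⊆ Prod.mk x ⁻¹' D := by
      intro ξ hξ j hj
      have : ξ j = i j := hξ j (by simpa using hj)
      change x ∈ C j (ξ j)
      rw [this]; exact hi j
    refine le_trans ?_ (measure_mono hsub)
    rw [Measure.infinitePi_pi _ fun j _ => measurableSet_singleton _]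
    simp only [hP, Finset.prod_const]
    refine pow_le_pow_right_of_le_one' ?_ hcard
    rw [ENNReal.inv_le_one]
    exact_mod_cast hQ
  have hint : μ univ * ((Q : ℝ≥0∞)⁻¹) ^ N ≤ ∫⁻ ξ, μ ((fun x => (x, ξ)) ⁻¹' D) ∂ℙ := by
    rw [← Measure.prod_apply_symm hD, Measure.prod_apply hD, mul_comm, ← lintegral_const]
    exact lintegral_mono_ae hsec
  have hfin : ∫⁻ ξ, μ ((fun x => (x, ξ)) ⁻¹' D) ∂ℙ ≠ ⊤ := by
    rw [← Measure.prod_apply_symm hD]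
    exact measure_ne_top _ _
  obtain ⟨ξ, hξ⟩ := exists_lintegral_le hfin
  exact ⟨ξ, hint.trans hξ⟩

/-- Markov's inequality for the number of sets of a sequence to which a point belongs. -/
theorem mul_measure_lt_encard_le {X : Type*} [MeasurableSpace X] (μ : Measure X)
    {Bad : ℕ → Set X} (hBad : ∀ j, MeasurableSet (Bad j)) (N : ℕ) :
    MeasurableSet {x | (N : ℕ∞) < {j | x ∈ Bad j}.encard} ∧
      (N : ℝ≥0∞) * μ {x | (N : ℕ∞) < {j | x ∈ Bad j}.encard} ≤ ∑' j, μ (Bad j) := by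
  let f : X → ℝ≥0∞ := fun x => ∑' j, (Bad j).indicator 1 x
  have hf : Measurable f := Measurable.tsum fun j => measurable_one.indicator (hBad j)
  have hfe : ∀ x, f x = (({j | x ∈ Bad j}.encard : ℕ∞) : ℝ≥0∞) := fun x => by
    rw [← ENNReal.tsum_set_one, tsum_subtype {j | x ∈ Bad j} (fun _ => (1 : ℝ≥0∞))]
    rfl
  have hset : {x | (N : ℕ∞) < {j | x ∈ Bad j}.encard} = {x | (N : ℝ≥0∞) < f x} := by
    ext x
    rw [mem_ofPred_eq, mem_ofPred_eq, hfe, ← ENat.toENNReal_coe, ENat.toENNReal_lt]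
  rw [hset]
  refine ⟨measurableSet_lt measurable_const hf, ?_⟩
  calc (N : ℝ≥0∞) * μ {x | (N : ℝ≥0∞) < f x} ≤ N * μ {x | (N : ℝ≥0∞) ≤ f x} := by
        gcongr with x; exact le_of_lt
    _ ≤ ∫⁻ x, f x ∂μ := mul_meas_ge_le_lintegral hf _
    _ = ∑' j, μ (Bad j) := by
        rw [lintegral_tsum fun j => (measurable_one.indicator (hBad j)).aemeasurable]
        exact tsum_congr fun j => by
          rw [lintegral_indicator (hBad j)]; simp

/-! ### The weak geometric lemma and small projections -/

namespace Heisenberg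

variable {k : ℕ}

theorem betaV_le_two_mul_betaV (E : Set (Heisenberg k)) (q : Heisenberg k) {r s : ℝ} (hr : 0 < r)
    (hrs : r ≤ s) (hsr : s ≤ 2 * r) : betaV E q r ≤ 2 * betaV E q s := by
  unfold betaV
  rw [ENNReal.mul_iInf_of_ne two_ne_zero ENNReal.ofNat_ne_top]
  refine le_iInf fun W => ?_
  rw [ENNReal.mul_iInf_of_ne two_ne_zero ENNReal.ofNat_ne_top]
  refine le_iInf fun hW => (iInf₂_le W hW).trans (iSup₂_le fun q' hq' => ?_)
  have hq's : q' ∈ Metric.closedBall q s ∩ E :=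
    ⟨Metric.closedBall_subset_closedBall hrs hq'.1, hq'.2⟩
  refine le_trans ?_ (mul_le_mul_right (le_iSup₂
    (f := fun q' (_ : q' ∈ Metric.closedBall q s ∩ E) =>
    Metric.infEDist q' W / ENNReal.ofReal s) q' hq's) 2)
  have hs0 : ENNReal.ofReal s ≠ 0 := by
    rw [Ne, ENNReal.ofReal_eq_zero, not_le]; linarith
  refine ENNReal.div_le_of_le_mul ?_
  set a := Metric.infEDist q' W
  calc a = a / ENNReal.ofReal s * ENNReal.ofReal s :=
        (ENNReal.div_mul_cancel hs0 ENNReal.ofReal_ne_top).symm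
    _ ≤ a / ENNReal.ofReal s * ENNReal.ofReal (2 * r) := by gcongr
    _ = 2 * (a / ENNReal.ofReal s) * ENNReal.ofReal r := by
        rw [ENNReal.ofReal_mul (by norm_num), ENNReal.ofReal_ofNat]; ring

/-- At a point and scale where `E` is well approximated by a vertical hyperplane with normal `ν'`,
the coordinate `⟨·, ν'⟩` hardly varies on `E`. -/
theorem exists_normal_of_betaV_le {E : Set (Heisenberg k)} {x : Heisenberg k} (hx : x ∈ E)
    {r ε : ℝ} (hr : 0 < r) (hε : 0 < ε) (h : betaV E x r ≤ ENNReal.ofReal ε) :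
    ∃ ν' : EuclideanSpace ℝ (Fin k ⊕ Fin k), ‖ν'‖ = 1 ∧
      ∀ q ∈ Metric.closedBall x r ∩ E, |(inner ℝ (x⁻¹ * q).v ν' : ℝ)| ≤ 4 * ε * r := by
  have hlt : betaV E x r < ENNReal.ofReal (2 * ε) :=
    h.trans_lt ((ENNReal.ofReal_lt_ofReal_iff (by linarith)).2 (by linarith))
  unfold betaV at hlt
  obtain ⟨W, hlt⟩ := iInf_lt_iff.1 hlt
  obtain ⟨⟨p, ν', hν', rfl⟩, hlt⟩ := iInf_lt_iff.1 hlt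
  refine ⟨ν', hν', ?_⟩
  have key : ∀ q ∈ Metric.closedBall x r ∩ E, |(inner ℝ (q.v - p.v) ν' : ℝ)| ≤ 2 * ε * r := by
    intro q hq
    have h1 := (le_iSup₂ (f := fun q (_ : q ∈ Metric.closedBall x r ∩ E) =>
      Metric.infEDist q ((fun q => p * q) '' vertical ν') / ENNReal.ofReal r) q hq).trans_lt hlt
    rw [ENNReal.div_lt_iff (Or.inl (by rw [Ne, ENNReal.ofReal_eq_zero]; linarith))
      (Or.inl ENNReal.ofReal_ne_top), ← ENNReal.ofReal_mul (by linarith),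
      Metric.infEDist_lt_iff] at h1
    obtain ⟨_, ⟨w, hw, rfl⟩, h2⟩ := h1
    rw [edist_dist, ENNReal.ofReal_lt_ofReal_iff (by positivity), dist_eq] at h2
    have h3 := (norm_v_le_koranyi _).trans h2.le
    have h4 := abs_real_inner_le_norm ((p * w)⁻¹ * q).v ν'
    have hw' : inner ℝ w.v ν' = (0 : ℝ) := hw
    rw [hν', mul_one] at h4
    refine le_trans (le_of_eq ?_) (h4.trans h3)
    congr 1
    simp only [mul_v, inv_v, inner_add_left, inner_neg_left, inner_sub_left, hw']
    ring
  intro q hq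
  have h1 := key q hq
  have h2 := key x ⟨Metric.mem_closedBall_self hr.le, hx⟩
  rw [inner_sub_left] at h1 h2
  rw [mul_v, inv_v, inner_add_left, inner_neg_left]
  rw [abs_le] at *
  constructor <;> linarith

/-- Points near a vertical hyperplane whose normal `ν'` is not orthogonal to `ν` do not see each
other in the cone around `ν`. -/
theorem notMem_posCone_of_inner_le {ν ν' : EuclideanSpace ℝ (Fin k ⊕ Fin k)} {M : ℝ} (hM : 1 ≤ M)
    (hνν' : 1 / (8 * M) < |(inner ℝ ν ν' : ℝ)|) (hν' : ‖ν'‖ = 1) {z : Heisenberg k} {r : ℝ}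
    (hz : r / 2 < koranyi z) (hr : 0 < r) (hzν : |(inner ℝ z.v ν' : ℝ)| ≤ r / (100 * M))
    (hν : ‖ν‖ = 1) : z ∉ posCone (1 / (16 * M)) ν := by
  rintro ⟨ha, hu, ht⟩
  set a : ℝ := inner ℝ z.v ν
  set m : ℝ := 1 / (16 * M) with hm
  have hm0 : 0 < m := by positivity
  have hm1 : m ≤ 1 / 16 := by rw [hm]; gcongr; linarith
  have hv : ‖z.v‖ ≤ 17 / 16 * a := by
    have h1 : ‖z.v‖ ≤ ‖z.v - a • ν‖ + ‖a • ν‖ := by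
      simpa using norm_add_le (z.v - a • ν) (a • ν)
    rw [norm_smul, hν, Real.norm_eq_abs, abs_of_nonneg ha, mul_one] at h1
    nlinarith
  -- The norm of an element of the cone is comparable to its `ν`-component.
  have har : r / 4 < a := by
    by_contra! hle
    have h1 := pow_lt_pow_left₀ hz (by positivity) four_ne_zero
    rw [koranyi_pow_four] at h1
    have h2 : ‖z.v‖ ^ 4 ≤ (17 / 16 * (r / 4)) ^ 4 := by
      gcongr; exact hv.trans (by gcongr)
    have h3 : |z.t| ≤ 1 / 16 * (r / 4) ^ 2 := ht.trans (by gcongr)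
    have h4 := pow_le_pow_left₀ (abs_nonneg _) h3 2
    rw [sq_abs] at h4
    have : 0 < r ^ 4 := by positivity
    nlinarith
  have hin : a * inner ℝ ν ν' = inner ℝ z.v ν' - inner ℝ (z.v - a • ν) ν' := by
    rw [inner_sub_left, real_inner_smul_left]; ring
  have h1 : |a * inner ℝ ν ν'| ≤ r / (100 * M) + m * a := by
    rw [hin]
    refine (abs_sub _ _).trans (add_le_add hzν ?_)
    have := abs_real_inner_le_norm (z.v - a • ν) ν'
    rw [hν', mul_one] at this
    exact this.trans hu
  rw [abs_mul, abs_of_nonneg ha] at h1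
  have hapos : 0 < a := by linarith
  have h2 : a * (1 / (8 * M)) < a * |inner ℝ ν ν'| := by gcongr
  have h3 : 1 / (8 * M) = 2 * m := by rw [hm]; field_simp; norm_num
  have h4 : r / (100 * M) = 4 / 25 * r * m := by rw [hm]; field_simp; norm_num
  rw [h3] at h2
  rw [h4] at h1
  nlinarith

/-- Discretization of the weak geometric lemma: the sets of points where `E` is badly approximated
at the scales `R / 2, R / 4, …` have summable measure. -/
theorem tsum_hausdorff_betaV_le {E : Set (Heisenberg k)} {ε B R : ℝ} {p : Heisenberg k}
    (hR : 0 < R)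
    (hB : ∫⁻ s in Ioo 0 R,
      hausdorff k {q ∈ E ∩ Metric.closedBall p R | ENNReal.ofReal ε < betaV E q s} /
        ENNReal.ofReal s ≤ ENNReal.ofReal B) :
    ∑' j : ℕ, hausdorff k {q ∈ E ∩ Metric.closedBall p R |
      ENNReal.ofReal (2 * ε) < betaV E q (R * (1 / 2) ^ (j + 1))} ≤ ENNReal.ofReal (2 * B) := by
  let f : ℕ → ℝ := fun j => R * (1 / 2) ^ j
  have hf : ∀ j, 0 < f j := fun j => by positivity
  have hfs : ∀ j, f j = 2 * f (j + 1) := fun j => by simp only [f]; ring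
  have hanti : Antitone f := antitone_nat_of_succ_le fun j => by linarith [hfs j, hf (j + 1)]
  have hdisj : Pairwise (Function.onFun Disjoint fun j => Ioo (f (j + 1)) (f j)) :=
    hanti.pairwise_disjoint_on_Ioo_succ
  have hsub : ⋃ j, Ioo (f (j + 1)) (f j) ⊆ Ioo 0 R := iUnion_subset fun j =>
    Ioo_subset_Ioo (hf _).le (by simpa [f] using hanti (Nat.zero_le j))
  set F : ℝ → ℝ≥0∞ := fun s =>
    hausdorff k {q ∈ E ∩ Metric.closedBall p R | ENNReal.ofReal ε < betaV E q s} /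
      ENNReal.ofReal s
  have hj : ∀ j, hausdorff k {q ∈ E ∩ Metric.closedBall p R |
      ENNReal.ofReal (2 * ε) < betaV E q (f (j + 1))} ≤
        2 * ∫⁻ s in Ioo (f (j + 1)) (f j), F s := fun j => by
    set A := hausdorff k {q ∈ E ∩ Metric.closedBall p R |
      ENNReal.ofReal (2 * ε) < betaV E q (f (j + 1))}
    have h0 : ENNReal.ofReal (f j) ≠ 0 := by
      rw [Ne, ENNReal.ofReal_eq_zero, not_le]; exact hf j
    have h1 : ∫⁻ _ in Ioo (f (j + 1)) (f j), A / ENNReal.ofReal (f j) ≤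
        ∫⁻ s in Ioo (f (j + 1)) (f j), F s := by
      refine setLIntegral_mono' measurableSet_Ioo fun s hs => ?_
      refine ENNReal.div_le_div (measure_mono ?_) (ENNReal.ofReal_le_ofReal hs.2.le)
      rintro q ⟨hq, hβ⟩
      refine ⟨hq, ?_⟩
      have h2 := hβ.trans_le (betaV_le_two_mul_betaV E q (hf _) hs.1.le (by linarith [hs.2, hfs j]))
      rw [ENNReal.ofReal_mul two_pos.le, ENNReal.ofReal_ofNat] at h2
      exact (ENNReal.mul_lt_mul_iff_right two_ne_zero ENNReal.ofNat_ne_top).1 h2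
    rw [setLIntegral_const, Real.volume_Ioo, show f j - f (j + 1) = f (j + 1) by linarith [hfs j]]
      at h1
    calc A = A / ENNReal.ofReal (f j) * ENNReal.ofReal (f j) :=
          (ENNReal.div_mul_cancel h0 ENNReal.ofReal_ne_top).symm
      _ = 2 * (A / ENNReal.ofReal (f j) * ENNReal.ofReal (f (j + 1))) := by
          conv_lhs => rw [hfs j, ENNReal.ofReal_mul two_pos.le, ENNReal.ofReal_ofNat, ← mul_assoc]
          rw [hfs j, ENNReal.ofReal_mul two_pos.le, ENNReal.ofReal_ofNat]
          ring
      _ ≤ _ := by gcongr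
  calc _ ≤ ∑' j, 2 * ∫⁻ s in Ioo (f (j + 1)) (f j), F s := ENNReal.tsum_le_tsum hj
    _ = 2 * ∫⁻ s in ⋃ j, Ioo (f (j + 1)) (f j), F s := by
        rw [ENNReal.tsum_mul_left, lintegral_iUnion (fun j => measurableSet_Ioo) hdisj]
    _ ≤ 2 * ∫⁻ s in Ioo 0 R, F s := by gcongr
    _ ≤ _ := by
        rw [ENNReal.ofReal_mul two_pos.le, ENNReal.ofReal_ofNat]; gcongr

/-- The points of `E` lying in some ball whose vertical projection is small compared with
the radius have, all together, a small vertical projection: by Vitali's covering lemma, the measures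
of the projections of these balls can be summed. -/
theorem hausdorff_projV_lowDensity_le {E : Set (Heisenberg k)} {C c : ℝ} (hc : 0 < c)
    (hup : ∀ (p : Heisenberg k) (r : ℝ), 0 < r →
      hausdorff k (Metric.closedBall p r ∩ E) ≤ ENNReal.ofReal (C * r ^ (2 * k + 1)))
    (hE : IsClosed E)
    (hlow : ∀ p ∈ E, ∀ r : ℝ, 0 < r → ENNReal.ofReal r < Metric.ediam E →
      ENNReal.ofReal (c * r ^ (2 * k + 1)) ≤ hausdorff k (Metric.closedBall p r ∩ E))
    {p : Heisenberg k} {r : ℝ} (hr : 0 < r) (hrE : ENNReal.ofReal r < Metric.ediam E)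
    (ν : EuclideanSpace ℝ (Fin k ⊕ Fin k)) {δ : ℝ} (hδ : 0 ≤ δ) :
    hausdorff k (projV ν '' {x ∈ Metric.closedBall p r ∩ E | ∃ ρ, 0 < ρ ∧ ρ ≤ 2 * r ∧
      hausdorff k (projV ν '' (Metric.closedBall x ρ ∩ E)) ≤
        ENNReal.ofReal (δ * ρ ^ (2 * k + 1))}) ≤
      ENNReal.ofReal (δ * (10 ^ (2 * k + 1) * C / c) * r ^ (2 * k + 1)) := by
  set L := {x ∈ Metric.closedBall p r ∩ E | ∃ ρ, 0 < ρ ∧ ρ ≤ 2 * r ∧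
      hausdorff k (projV ν '' (Metric.closedBall x ρ ∩ E)) ≤
        ENNReal.ofReal (δ * ρ ^ (2 * k + 1))}
  have hL : ∀ x ∈ L, ∃ ρ, 0 < ρ ∧ ρ ≤ 2 * r ∧
      hausdorff k (projV ν '' (Metric.closedBall x ρ ∩ E)) ≤
        ENNReal.ofReal (δ * ρ ^ (2 * k + 1)) := fun x hx => hx.2
  choose! ρ hρ0 hρr hρδ using hL
  obtain ⟨u, huL, hud, hucov⟩ := Vitali.exists_disjoint_subfamily_covering_enlargement_closedBall
    L id (fun x => ρ x / 5) (2 * r / 5) (fun x hx => by gcongr; exact hρr x hx) 5 (by norm_num)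
  have hcount : Countable u := (hud.countable_of_nonempty_interior fun a ha =>
    ⟨a, mem_interior_iff_mem_nhds.2
      (Metric.closedBall_mem_nhds a (by have := hρ0 a (huL ha); positivity))⟩).to_subtype
  have hsub : projV ν '' L ⊆ ⋃ b : u,
      projV ν '' (Metric.closedBall (b : Heisenberg k) (ρ b) ∩ E) := by
    rintro _ ⟨x, hx, rfl⟩
    obtain ⟨b, hb, hxb⟩ := hucov x hx
    refine mem_iUnion.2 ⟨⟨b, hb⟩, x, ⟨?_, hx.1.2⟩, rfl⟩
    have := hxb (Metric.mem_closedBall_self (by have := hρ0 x hx; positivity))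
    rwa [mul_div_cancel₀ _ (by norm_num : (5 : ℝ) ≠ 0)] at this
  calc hausdorff k (projV ν '' L)
      ≤ ∑' b : u, hausdorff k (projV ν '' (Metric.closedBall (b : Heisenberg k) (ρ b) ∩ E)) :=
        (measure_mono hsub).trans (measure_iUnion_le _)
    _ ≤ ∑' b : u, ENNReal.ofReal (δ * 5 ^ (2 * k + 1) / c) *
          hausdorff k (Metric.closedBall (b : Heisenberg k) (ρ b / 5) ∩ E) := by
        refine ENNReal.tsum_le_tsum fun b => (hρδ b (huL b.2)).trans ?_
        have h0 := hρ0 b (huL b.2)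
        have h1 := hρr b (huL b.2)
        refine le_trans (le_of_eq ?_) (mul_le_mul_right (hlow b (huL b.2).1.2 (ρ b / 5)
          (by positivity) ((ENNReal.ofReal_le_ofReal (by linarith)).trans_lt hrE)) _)
        rw [← ENNReal.ofReal_mul (by positivity), div_pow]
        congr 1
        field_simp
    _ ≤ ENNReal.ofReal (δ * 5 ^ (2 * k + 1) / c) *
          hausdorff k (Metric.closedBall p (2 * r) ∩ E) := by
        rw [ENNReal.tsum_mul_left]
        gcongr
        refine (tsum_meas_le_meas_iUnion_of_disjoint (hausdorff k)
          (fun b : u => (Metric.isClosed_closedBall.inter hE).measurableSet)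
          fun a b hab => ((hud.subtype _ _) hab).mono inter_subset_left inter_subset_left).trans
          (measure_mono (iUnion_subset fun b => inter_subset_inter_left _ ?_))
        refine Metric.closedBall_subset_closedBall' ?_
        have h1 := hρr b (huL b.2)
        have h2 := Metric.mem_closedBall.1 (huL b.2).1.1
        change ρ b / 5 + dist (b : Heisenberg k) p ≤ 2 * r
        linarith
    _ ≤ ENNReal.ofReal (δ * 5 ^ (2 * k + 1) / c) * ENNReal.ofReal (C * (2 * r) ^ (2 * k + 1)) := by
        gcongr; exact hup p _ (by positivity)
    _ = _ := by
        rw [← ENNReal.ofReal_mul (by positivity), show (10 : ℝ) = 5 * 2 by norm_num, mul_pow,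
          mul_pow]
        congr 1; ring

/-- Separated families in an Ahlfors-regular set have bounded cardinality. -/
theorem exists_dist_lt_of_card_gt {E : Set (Heisenberg k)} {C c : ℝ}
    (hup : ∀ (p : Heisenberg k) (r : ℝ), 0 < r →
      hausdorff k (Metric.closedBall p r ∩ E) ≤ ENNReal.ofReal (C * r ^ (2 * k + 1)))
    (hC : 0 < C) (hE : IsClosed E)
    (hlow : ∀ p ∈ E, ∀ r : ℝ, 0 < r → ENNReal.ofReal r < Metric.ediam E →
      ENNReal.ofReal (c * r ^ (2 * k + 1)) ≤ hausdorff k (Metric.closedBall p r ∩ E))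
    {Q : ℕ} (hQ : C * 81 ^ (2 * k + 1) < Q * c) {r : ℝ} (hr : 0 < r)
    (hrE : ENNReal.ofReal (r / 9) < Metric.ediam E) (x : Heisenberg k) (z : Fin Q → Heisenberg k)
    (hz : ∀ i, z i ∈ E) (hxz : ∀ i, dist x (z i) ≤ 8 * r) :
    ∃ i j, i < j ∧ dist (z j) (z i) < r / 4 := by
  by_contra! hsep
  have hdisj : ∀ i j, i < j → Disjoint (Metric.closedBall (z i) (r / 9) ∩ E)
      (Metric.closedBall (z j) (r / 9) ∩ E) := fun i j hij =>
    (Metric.closedBall_disjoint_closedBall (by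
      rw [dist_comm]; linarith [hsep i j hij])).mono inter_subset_left inter_subset_left
  have h1 : ∑' i : Fin Q, hausdorff k (Metric.closedBall (z i) (r / 9) ∩ E) ≤
      hausdorff k (Metric.closedBall x (9 * r) ∩ E) := by
    refine (tsum_meas_le_meas_iUnion_of_disjoint (hausdorff k)
      (fun i => (Metric.isClosed_closedBall.inter hE).measurableSet) fun i j hij =>
      (lt_or_gt_of_ne hij).elim (hdisj i j) fun h => (hdisj j i h).symm).trans
      (measure_mono (iUnion_subset fun i => inter_subset_inter_left _ ?_))
    refine Metric.closedBall_subset_closedBall' ?_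
    rw [dist_comm]
    linarith [hxz i]
  have h2 : ∑' _ : Fin Q, ENNReal.ofReal (c * (r / 9) ^ (2 * k + 1)) ≤
      ENNReal.ofReal (C * (9 * r) ^ (2 * k + 1)) :=
    (ENNReal.tsum_le_tsum fun i => hlow (z i) (hz i) (r / 9) (by positivity) hrE).trans
      (h1.trans (hup x _ (by positivity)))
  rw [tsum_fintype, Finset.sum_const, Finset.card_univ, Fintype.card_fin, nsmul_eq_mul,
    ← ENNReal.ofReal_natCast, ← ENNReal.ofReal_mul (by positivity),
    ENNReal.ofReal_le_ofReal_iff (by positivity),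
    show C * (9 * r) ^ (2 * k + 1) = C * 81 ^ (2 * k + 1) * (r / 9) ^ (2 * k + 1) by
      rw [mul_assoc, ← mul_pow]; congr 2; ring, ← mul_assoc] at h2
  exact absurd (le_of_mul_le_mul_right h2 (by positivity)) (not_le.2 hQ)

end Heisenberg

/-! ### Selection of a large subset without cone pairs -/

namespace Heisenberg

variable {k : ℕ}

/-- The core of the argument, at a fixed ball `B(p, r)` with a large vertical projection. The
parameters are: `b`, the size of the projection; `δ`, below which the projection of a ball counts as
small; `M`, which measures the aperture of the cone; `B`, the constant of the weak geometric lemma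
at the corresponding threshold; `N`, the admissible number of bad scales; `Q`, the number of
colours. -/
theorem exists_large_subset_forall_notMem_posCone {E : Set (Heisenberg k)} (hE : IsClosed E)
    {C c : ℝ} (hC : 0 < C) (hc : 0 < c)
    (hup : ∀ (p : Heisenberg k) (r : ℝ), 0 < r →
      hausdorff k (Metric.closedBall p r ∩ E) ≤ ENNReal.ofReal (C * r ^ (2 * k + 1)))
    (hlow : ∀ p ∈ E, ∀ r : ℝ, 0 < r → ENNReal.ofReal r < Metric.ediam E →
      ENNReal.ofReal (c * r ^ (2 * k + 1)) ≤ hausdorff k (Metric.closedBall p r ∩ E))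
    {b δ B : ℝ} {M N Q : ℕ} (hb : 0 < b) (hδ : 0 < δ) (hM : 0 < M) (hN : 0 < N)
    (hQ : C * 81 ^ (2 * k + 1) < Q * c)
    (hMδ : 32 ^ (2 * k + 1) / M ≤ δ) (hδb : δ * (10 ^ (2 * k + 1) * C / c) ≤ b / 4)
    (hNb : 32 ^ (2 * k + 1) * (2 * (B * 4 ^ (2 * k + 1)) / N) ≤ b / 4)
    {p : Heisenberg k} {r : ℝ} (hr : 0 < r) (hrE : ENNReal.ofReal r < Metric.ediam E)
    (hWGL : ∫⁻ s in Ioo 0 (4 * r),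
      hausdorff k {q ∈ E ∩ Metric.closedBall p (4 * r) |
        ENNReal.ofReal (1 / (800 * M)) < betaV E q s} / ENNReal.ofReal s ≤
      ENNReal.ofReal (B * (4 * r) ^ (2 * k + 1)))
    {ν : EuclideanSpace ℝ (Fin k ⊕ Fin k)} (hν : ‖ν‖ = 1)
    (hproj : ENNReal.ofReal (b * r ^ (2 * k + 1)) ≤
      hausdorff k (projV ν '' (Metric.closedBall p r ∩ E))) :
    ∃ F ⊆ Metric.closedBall p r ∩ E,
      (∀ x ∈ F, ∀ y ∈ F, x⁻¹ * y ∈ posCone (1 / (16 * M)) ν → x = y) ∧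
      ENNReal.ofReal (b / (2 * 32 ^ (2 * k + 1)) * (1 / Q) ^ N * r ^ (2 * k + 1)) ≤
        hausdorff k F := by
  have hM1 : (1 : ℝ) ≤ M := by exact_mod_cast hM
  have hNR : (0 : ℝ) < N := by exact_mod_cast hN
  have hQR : (0 : ℝ) < Q := by
    by_contra! h
    have h1 : (Q : ℝ) * c ≤ 0 := mul_nonpos_of_nonpos_of_nonneg h hc.le
    have h2 : 0 < C * 81 ^ (2 * k + 1) := by positivity
    linarith
  let rad : ℕ → ℝ := fun j => 4 * r * (1 / 2) ^ (j + 1)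
  have hrad : ∀ j, 0 < rad j := fun j => by positivity
  have hrad2 : ∀ j, rad j ≤ 2 * r := fun j => by
    have : ((1 : ℝ) / 2) ^ j ≤ 1 := pow_le_one₀ (by norm_num) (by norm_num)
    calc rad j = 2 * r * (1 / 2) ^ j := by simp only [rad]; ring
      _ ≤ 2 * r * 1 := by gcongr
      _ = 2 * r := mul_one _
  -- Measurable hulls cost no measure, and points outside the hull still have small `β`-number.
  let Bad : ℕ → Set (Heisenberg k) := fun j => toMeasurable (hausdorff k)
    {q ∈ E ∩ Metric.closedBall p (4 * r) |
      ENNReal.ofReal (2 * (1 / (800 * M))) < betaV E q (rad j)}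
  have hBad : ∀ j, MeasurableSet (Bad j) := fun j => measurableSet_toMeasurable _ _
  set S := Metric.closedBall p r ∩ E with hS
  have hSm : MeasurableSet S := (Metric.isClosed_closedBall.inter hE).measurableSet
  let D := {x | (N : ℕ∞) < {j | x ∈ Bad j}.encard}
  obtain ⟨hDm, hDN⟩ := mul_measure_lt_encard_le (hausdorff k) hBad N
  let L := {x ∈ S | ∃ ρ, 0 < ρ ∧ ρ ≤ 2 * r ∧
    hausdorff k (projV ν '' (Metric.closedBall x ρ ∩ E)) ≤
      ENNReal.ofReal (δ * ρ ^ (2 * k + 1))}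
  let G := S \ (L ∪ D)
  have hGS : G ⊆ S := sdiff_subset
  -- The points of `D` and `L` cover at most half of the projection of `B(p, r) ∩ E`.
  have hL : hausdorff k (projV ν '' L) ≤ ENNReal.ofReal (b / 4 * r ^ (2 * k + 1)) :=
    (hausdorff_projV_lowDensity_le hc hup hE hlow hr hrE ν hδ.le).trans
      (ENNReal.ofReal_le_ofReal (by gcongr))
  have hD : hausdorff k (projV ν '' D) ≤ ENNReal.ofReal (b / 4 * r ^ (2 * k + 1)) := by
    have h1 := hDN.trans (le_of_eq (tsum_congr fun j => measure_toMeasurable _))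
    have h2 := h1.trans (tsum_hausdorff_betaV_le (by positivity) hWGL)
    have h3 : hausdorff k D ≤ ENNReal.ofReal (2 * (B * (4 * r) ^ (2 * k + 1)) / N) := by
      rw [ENNReal.ofReal_div_of_pos hNR, ENNReal.ofReal_natCast,
        ENNReal.le_div_iff_mul_le (Or.inl (by exact_mod_cast hN.ne')) (Or.inl (by simp)), mul_comm]
      exact h2
    refine (hausdorff_projV_le hν D).trans ((mul_le_mul_right h3 _).trans ?_)
    rw [← ENNReal.ofReal_mul (by positivity)]
    refine ENNReal.ofReal_le_ofReal ?_
    calc _ = 32 ^ (2 * k + 1) * (2 * (B * 4 ^ (2 * k + 1)) / N) * r ^ (2 * k + 1) := by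
          rw [mul_pow]; ring
      _ ≤ _ := by gcongr
  have hG : ENNReal.ofReal (b / (2 * 32 ^ (2 * k + 1)) * r ^ (2 * k + 1)) ≤ hausdorff k G := by
    have hcover : projV ν '' S ⊆ projV ν '' G ∪ (projV ν '' L ∪ projV ν '' D) := by
      rw [← image_union, ← image_union]
      exact image_mono fun x hx => (em (x ∈ L ∪ D)).elim Or.inr fun h => Or.inl ⟨hx, h⟩
    have h1 := hproj.trans ((measure_mono hcover).trans ((measure_union_le _ _).trans
      (add_le_add_right ((measure_union_le _ _).trans (add_le_add hL hD)) _)))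
    rw [← ENNReal.ofReal_add (by positivity) (by positivity), ← tsub_le_iff_right,
      ← ENNReal.ofReal_sub _ (by positivity)] at h1
    have h2 := h1.trans (hausdorff_projV_le hν G)
    rw [← ENNReal.div_le_iff' (by rw [Ne, ENNReal.ofReal_eq_zero, not_le]; positivity)
      ENNReal.ofReal_ne_top, ← ENNReal.ofReal_div_of_pos (by positivity)] at h2
    refine le_trans (le_of_eq ?_) h2
    congr 1; field_simp; ring
  have hcol : ∀ j, ∃ K : Fin Q → Set (Heisenberg k), (∀ i, IsOpen (K i)) ∧
      (∀ x ∈ S, ∃ i, x ∈ K i) ∧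
      ∀ i, ∀ x ∈ K i, ∀ y ∈ K i, dist x y ≤ rad j → dist x y ≤ rad j / 2 := fun j =>
    exists_open_cover_forall_dist_le_half S (hrad j) fun x hx z hz hxz =>
      exists_dist_lt_of_card_gt hup hC hE hlow hQ (hrad j)
        ((ENNReal.ofReal_le_ofReal (by linarith [hrad2 j])).trans_lt hrE) x z
        (fun i => (hz i).2) hxz
  choose K hKo hKcov hKd using hcol
  have hGfin : hausdorff k G < ⊤ :=
    (measure_mono hGS).trans_lt ((hup p r hr).trans_lt ENNReal.ofReal_lt_top)
  have : IsFiniteMeasure ((hausdorff k).restrict G) := ⟨by simpa using hGfin⟩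
  -- `L`, hence `G`, may fail to be measurable; only measurable supersets of `G` are used.
  have haeS : ∀ᵐ x ∂((hausdorff k).restrict G), x ∈ S :=
    ae_restrict_of_ae_restrict_of_subset hGS (ae_restrict_mem hSm)
  have haeD : ∀ᵐ x ∂((hausdorff k).restrict G), x ∈ Dᶜ :=
    ae_restrict_of_ae_restrict_of_subset (fun x hx h => hx.2 (Or.inr h))
      (ae_restrict_mem hDm.compl)
  obtain ⟨ξ, hξ⟩ := exists_colour_sequence ((hausdorff k).restrict G) (by exact_mod_cast hQR) hBad
    (fun j i => (hKo j i).measurableSet) (haeS.mono fun x hx j => hKcov j x hx)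
    (haeD.mono fun x hx => not_lt.1 hx)
  have hFm : MeasurableSet {x | ∀ j, x ∈ Bad j → x ∈ K j (ξ j)} := by
    simp only [ofPred_forall]
    exact MeasurableSet.iInter fun j => (hBad j).himp (hKo j (ξ j)).measurableSet
  rw [Measure.restrict_apply hFm, Measure.restrict_apply_univ] at hξ
  -- At a good scale `j` of `x`, points of `E` at distance about `rad j` from `x` avoid the cone.
  have hgood : ∀ x ∈ G, ∀ y ∈ S, ∀ j, rad j / 2 < dist x y → dist x y ≤ rad j → x ∉ Bad j →
      x⁻¹ * y ∉ posCone (1 / (16 * M)) ν ∧ (x⁻¹ * y)⁻¹ ∉ posCone (1 / (16 * M)) ν := by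
    intro x hx y hy j hlt hle hxj
    have hβ : betaV E x (rad j) ≤ ENNReal.ofReal (2 * (1 / (800 * M))) := by
      by_contra! h
      refine hxj (subset_toMeasurable _ _ ⟨⟨hx.1.2, ?_⟩, h⟩)
      exact Metric.closedBall_subset_closedBall (by linarith) hx.1.1
    obtain ⟨ν', hν', hnear⟩ := exists_normal_of_betaV_le hx.1.2 (hrad j) (by positivity) hβ
    have hnear' : ∀ q ∈ Metric.closedBall x (rad j) ∩ E,
        |(inner ℝ (x⁻¹ * q).v ν' : ℝ)| ≤ rad j / (100 * M) := fun q hq =>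
      (hnear q hq).trans_eq (by field_simp; ring)
    have hang : 1 / (8 * M) < |(inner ℝ ν ν' : ℝ)| := by
      by_contra! h
      refine hx.2 (Or.inl ⟨hx.1, rad j, hrad j, hrad2 j, ?_⟩)
      refine (hausdorff_projV_le_of_inner_le hν hν' hM h (hrad j) x (fun q hq => hq.1)
        fun q hq => (hnear' q hq).trans ?_).trans (ENNReal.ofReal_le_ofReal ?_)
      · have := (hrad j).le
        gcongr; norm_num
      · have := (hrad j).le
        gcongr
    have hyx : y ∈ Metric.closedBall x (rad j) ∩ E :=
      ⟨by rwa [Metric.mem_closedBall, dist_comm], hy.2⟩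
    have hk : rad j / 2 < koranyi (x⁻¹ * y) := by rwa [← dist_eq, dist_comm]
    refine ⟨notMem_posCone_of_inner_le hM1 hang hν' hk (hrad j) (hnear' y hyx) hν,
      notMem_posCone_of_inner_le hM1 hang hν' ?_ (hrad j) ?_ hν⟩
    · rwa [koranyi_inv]
    · rw [inv_v, inner_neg_left, abs_neg]
      exact hnear' y hyx
  refine ⟨{x | ∀ j, x ∈ Bad j → x ∈ K j (ξ j)} ∩ G, inter_subset_right.trans hGS, ?_, ?_⟩
  · rintro x ⟨hxξ, hxG⟩ y ⟨hyξ, hyG⟩ hxy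
    by_contra hne
    have hpos : 0 < dist x y := dist_pos.2 hne
    have hle : dist x y ≤ 2 * r := by
      have h1 := Metric.mem_closedBall.1 hxG.1.1
      have h2 := Metric.mem_closedBall.1 hyG.1.1
      linarith [dist_triangle_right x y p]
    obtain ⟨j, hj1, hj2⟩ := exists_nat_pow_near_of_lt_one (div_pos hpos (by positivity : 0 < 2 * r))
      ((div_le_one (by positivity)).2 hle) (by norm_num : (0 : ℝ) < 1 / 2) (by norm_num)
    rw [lt_div_iff₀ (by positivity)] at hj1
    rw [div_le_iff₀ (by positivity)] at hj2
    have hlt : rad j / 2 < dist x y := by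
      refine lt_of_eq_of_lt ?_ hj1
      simp only [rad]; ring
    have hle' : dist x y ≤ rad j := by
      refine hj2.trans_eq ?_
      simp only [rad]; ring
    by_cases hx : x ∈ Bad j
    · by_cases hy : y ∈ Bad j
      · exact absurd (hKd j (ξ j) x (hxξ j hx) y (hyξ j hy) hle') (not_le.2 hlt)
      · refine (hgood y hyG x hxG.1 j (by rwa [dist_comm]) (by rwa [dist_comm]) hy).2 ?_
        simpa using hxy
    · exact (hgood x hxG y hyG.1 j hlt hle' hx).1 hxy
  · refine le_trans ?_ hξ
    refine le_trans (le_of_eq ?_) (mul_le_mul_left hG _)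
    rw [← ENNReal.ofReal_natCast, ← ENNReal.ofReal_inv_of_pos hQR,
      ← ENNReal.ofReal_pow (by positivity), ← ENNReal.ofReal_mul (by positivity), one_div]
    congr 1; ring

end Heisenberg

theorem mainTheorem10 (k : ℕ) (hk : 1 ≤ k) (E : Set (Heisenberg k)) (hE : IsClosed E)
    (hreg : Heisenberg.AhlforsRegular E) (hbvp : Heisenberg.HasBVP E)
    (hwgl : Heisenberg.SatisfiesWGL E) :
    Heisenberg.HasBPiLG E := by
  obtain ⟨⟨C, hC, hup⟩, c, hc, hlow⟩ := hreg
  obtain ⟨b, hb, hproj⟩ := hbvp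
  let δ : ℝ := b * c / (4 * 10 ^ (2 * k + 1) * C)
  have hδ : 0 < δ := by positivity
  obtain ⟨M, hM⟩ := exists_nat_gt (32 ^ (2 * k + 1) / δ)
  have hMR : (0 : ℝ) < M := lt_trans (by positivity) hM
  obtain ⟨B, hB, hWGL⟩ := hwgl (1 / (800 * M)) (by positivity)
  obtain ⟨Q, hQ⟩ := exists_nat_gt (C * 81 ^ (2 * k + 1) / c)
  have hQR : (0 : ℝ) < Q := lt_trans (by positivity) hQ
  obtain ⟨N, hN⟩ := exists_nat_gt (32 ^ (2 * k + 1) * (2 * (B * 4 ^ (2 * k + 1))) / (b / 4))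
  have hNR : (0 : ℝ) < N := lt_trans (by positivity) hN
  refine ⟨2 / (1 / (16 * M)), b / (2 * 32 ^ (2 * k + 1)) * (1 / Q) ^ N, by positivity,
    by positivity, fun p hp r hr hrE => ?_⟩
  obtain ⟨ν, hν, hνp⟩ := hproj p hp r hr hrE
  obtain ⟨F, hFS, hF, hFH⟩ := Heisenberg.exists_large_subset_forall_notMem_posCone hE hC hc hup hlow
    hb hδ (by exact_mod_cast hMR) (by exact_mod_cast hNR) (by rwa [div_lt_iff₀ hc] at hQ)
    (M := M) (by rw [div_lt_comm₀ (by positivity) hMR] at hM; exact hM.le)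
    (by simp only [δ]; field_simp; exact le_rfl)
    (N := N) (by
      rw [div_lt_comm₀ (by positivity) hNR] at hN
      rw [← mul_div_assoc]; exact hN.le)
    hr hrE (hWGL p hp (4 * r) (by positivity)) hν hνp
  have hne : F.Nonempty := by
    rw [nonempty_iff_ne_empty]
    rintro rfl
    rw [measure_empty, nonpos_iff_eq_zero, ENNReal.ofReal_eq_zero] at hFH
    exact absurd hFH (not_le.2 (by positivity))
  have hM16 : 1 / (16 * (M : ℝ)) ≤ 1 := by
    have : (1 : ℝ) ≤ M := by exact_mod_cast (Nat.cast_pos.1 hMR : 0 < M)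
    rw [div_le_one (by positivity)]; linarith
  obtain ⟨Γ, hFΓ, hΓ⟩ := Heisenberg.exists_isIntrinsicLipschitzGraphOver_superset hν
    (by positivity) hM16 hne (R := r + dist p 1) (fun q hq => by
      have h1 := Heisenberg.norm_v_le_koranyi q
      have h2 : dist q 1 = Heisenberg.koranyi q := by rw [Heisenberg.dist_eq, inv_one, one_mul]
      have h3 := Metric.mem_closedBall.1 (hFS hq).1
      linarith [dist_triangle q p 1]) hF
  exact ⟨Γ, ⟨ν, hν, hΓ⟩, hFH.trans (measure_mono fun q hq => ⟨hFS hq, hFΓ hq⟩)⟩
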